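/- Conventions. Let $U\subseteq\mathbb R^2$ be open. For a Lie algebra $L$ of smooth vector fields on an open set $\Omega$, the orbit of a point consists of the points reached from it by following finitely many integral curves in $\Omega$ of fields in $L$; the rank of $L$ is the dimension of its generic (highest-dimensional) orbits. A Lie algebra of vector fields on $U$ is called five-dimensional if its restriction to every nonempty open subset of $U$ has dimension $5$ (for real-analytic fields on a connected $U$ this is ordinary five-dimensionality). Theorem. Let $\mathfrak g$ be a five-dimensional Lie algebra of smooth vector fields on $U$ whose commutator $\mathfrak g'=[\mathfrak g,\mathfrak g]$ is abelian of rank $1$ and has an abelian complement $A$: $A$ is an abelian subalgebra with $\mathfrak g=A\oplus\mathfrak g'$ as vector spaces. Suppose that $A$ has a basis $(e_1,e_2)$ and $\mathfrak g'$ contains nonzero fields $w,e_4,e_5$ that are weight vectors of weights $(0,k),(\lambda,k),(\mu,k)$, i.e. $$[e_1,w]=0,\quad [e_1,e_4]=\lambda e_4,\quad [e_1,e_5]=\mu e_5,\qquad [e_2,v]=kv\ \text{ for } v\in\{w,e_4,e_5\},$$ where $k,\lambda,\mu$ are nonzero real numbers and $\lambda\ne\mu$. Let $Z_A(w)$ be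 the centralizer of $w$ in $A$ and suppose that $\langle Z_A(w),w\rangle$ has rank $2$. By canonical coordinates for $\langle Z_A(w),w\rangle$ we mean smooth coordinates $(x,y)$ on a connected open subset of $U$ in which $e_1=\partial_x$ and $w=\partial_y$. (1) There are points of $U$ whose orbit under $\langle Z_A(w),w\rangle$ has dimension $2$, and canonical coordinates exist around every such point. (2) For any canonical coordinates $(x,y)$ there is a constant $\beta$ such that, after replacing $y$ by $y+\beta$, the coordinates are still canonical and, on their domain of values $W\subseteq\mathbb R^2$, $$A=\langle\partial_x,\;y\partial_y\rangle,\qquad \mathfrak g'=\langle\partial_y,\;e^{\lambda x}\partial_y,\;e^{\mu x}\partial_y\rangle,\qquad \mathfrak g=\langle\partial_x,\;y\partial_y\rangle\oplus\langle\partial_y,\;e^{\lambda x}\partial_y,\;e^{\mu x}\partial_y\rangle .$$ (3) Let $\mathfrak g$ act through its third prolongation on the extended space $W\times\mathbb R^3$ with coordinates $(x,y,y',y'',y''')$, where $(x,y)$ are the coordinates of (2), and let $$\Sigma=\{\,y'''-(\lambda+\mu)y''+\lambda\mu y'=0\,\}\subset W\times\mathbb R^3 .$$ The orbit of every point off $\Sigma$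 is five-dimensional, and the orbit of every point of $\Sigma$ has dimension less than $5$. (4) $\Sigma$ is a smooth hypersurface, and it is the only invariant one: a nonempty smooth embedded hypersurface of $W\times\mathbb R^3$ is a union of $\mathfrak g$-orbits if and only if it equals $\Sigma$. Moreover, for $D\subseteq W\times\mathbb R^2$ open and $F:D\to\mathbb R$ differentiable, the prolonged fields are tangent to the graph $y'''=F(x,y,y',y'')$ if and only if $F=(\lambda+\mu)y''-\lambda\mu y'$ on $D$. -/

import Mathlib

open Set TopologicalSpace VectorField
open scoped ContDiff Topology ENNReal

noncomputable section

/-! ### Lie algebras of smooth vector fields on open subsets of the plane -/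

/-- The plane, with coordinates `(x, y)`. -/
abbrev Plane : Type := ℝ × ℝ

/-- Smooth vector fields on the open set `U`. They are represented by functions on the whole plane
that vanish off `U`, so that two of them are equal exactly if they agree on `U`. -/
def smoothFields (U : Opens Plane) : Submodule ℝ (Plane → Plane) where
  carrier := {X | ContDiffOn ℝ ∞ X U ∧ ∀ p, p ∉ U → X p = 0}
  add_mem' := fun {X Y} hX hY =>
    ⟨hX.1.add hY.1, fun p hp => by simp [hX.2 p hp, hY.2 p hp]⟩
  zero_mem' := ⟨contDiffOn_const, fun _ _ => rfl⟩
  smul_mem' := fun c X hX =>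
    ⟨contDiffOn_const.smul hX.1, fun p hp => by simp [hX.2 p hp]⟩

/-- The type of smooth vector fields on `U`. -/
abbrev VF (U : Opens Plane) : Type := smoothFields U

namespace VF

variable {U : Opens Plane}

/-- A vector field as a function `p ↦ X p`. -/
instance : CoeFun (VF U) (fun _ => Plane → Plane) := ⟨fun X => X.1⟩

theorem ext_on {X Y : VF U} (h : ∀ p ∈ U, X p = Y p) : X = Y := by
  apply Subtype.ext
  funext p
  by_cases hp : p ∈ U
  · exact h p hp
  · rw [X.2.2 p hp, Y.2.2 p hp]

theorem contDiffAt (X : VF U) {p : Plane} (hp : p ∈ U) : ContDiffAt ℝ ∞ X p :=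
  X.2.1.contDiffAt (U.isOpen.mem_nhds hp)

theorem differentiableAt (X : VF U) {p : Plane} (hp : p ∈ U) : DifferentiableAt ℝ X p :=
  (X.contDiffAt hp).differentiableAt (by simp)

open Classical in
/-- The vector field on `U` with the values of `f`, for `f` smooth on `U`. -/
def mk' (f : Plane → Plane) (hf : ContDiffOn ℝ ∞ f U) : VF U :=
  ⟨fun p => if p ∈ U then f p else 0,
    hf.congr fun _ hp => if_pos hp, fun _ hp => if_neg hp⟩

theorem mk'_apply {f : Plane → Plane} {hf : ContDiffOn ℝ ∞ f U} {p : Plane} (hp : p ∈ U) :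
    mk' f hf p = f p := if_pos hp

theorem mk'_eventuallyEq {f : Plane → Plane} {hf : ContDiffOn ℝ ∞ f U} {p : Plane}
    (hp : p ∈ U) : (mk' f hf : Plane → Plane) =ᶠ[𝓝 p] f := by
  filter_upwards [U.isOpen.mem_nhds hp] with q hq using mk'_apply hq

/-- The bracket of vector fields, `[X, Y] = DY(X) - DX(Y)`. -/
instance : Bracket (VF U) (VF U) where
  bracket X Y := mk' (lieBracket ℝ X Y) fun p hp =>
    ((X.contDiffAt hp).lieBracket_vectorField (Y.contDiffAt hp)
      (m := ∞) (by simp)).contDiffWithinAt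

theorem bracket_apply (X Y : VF U) {p : Plane} (hp : p ∈ U) :
    ⁅X, Y⁆ p = lieBracket ℝ X Y p := mk'_apply hp

theorem bracket_eventuallyEq (X Y : VF U) {p : Plane} (hp : p ∈ U) :
    (⁅X, Y⁆ : VF U).1 =ᶠ[𝓝 p] lieBracket ℝ X Y := mk'_eventuallyEq hp

instance : LieRing (VF U) where
  add_lie X Y Z := ext_on fun p hp => by
    change _ = ⁅X, Z⁆ p + ⁅Y, Z⁆ p
    rw [bracket_apply _ _ hp, bracket_apply _ _ hp, bracket_apply _ _ hp]
    exact lieBracket_add_left (X.differentiableAt hp) (Y.differentiableAt hp)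
  lie_add X Y Z := ext_on fun p hp => by
    change _ = ⁅X, Y⁆ p + ⁅X, Z⁆ p
    rw [bracket_apply _ _ hp, bracket_apply _ _ hp, bracket_apply _ _ hp]
    exact lieBracket_add_right (Y.differentiableAt hp) (Z.differentiableAt hp)
  lie_self X := ext_on fun p hp => by
    rw [bracket_apply _ _ hp, lieBracket_self]; rfl
  leibniz_lie X Y Z := ext_on fun p hp => by
    change _ = ⁅⁅X, Y⁆, Z⁆ p + ⁅Y, ⁅X, Z⁆⁆ p
    rw [bracket_apply _ _ hp, bracket_apply _ _ hp, bracket_apply _ _ hp,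
      Filter.EventuallyEq.lieBracket_vectorField_eq Filter.EventuallyEq.rfl
        (bracket_eventuallyEq Y Z hp),
      Filter.EventuallyEq.lieBracket_vectorField_eq (bracket_eventuallyEq X Y hp)
        Filter.EventuallyEq.rfl,
      Filter.EventuallyEq.lieBracket_vectorField_eq Filter.EventuallyEq.rfl
        (bracket_eventuallyEq X Z hp)]
    exact leibniz_identity_lieBracket (n := ∞) (by simpa using WithTop.coe_le_coe.2 (le_top : (2 : ℕ∞) ≤ ⊤)) (X.contDiffAt hp)
      (Y.contDiffAt hp) (Z.contDiffAt hp)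

instance : LieAlgebra ℝ (VF U) where
  lie_smul c X Y := ext_on fun p hp => by
    change _ = c • ⁅X, Y⁆ p
    rw [bracket_apply _ _ hp, bracket_apply _ _ hp]
    exact lieBracket_const_smul_right (Y.differentiableAt hp)

/-- Restriction of vector fields to a smaller open set. -/
def restrict {V : Opens Plane} (h : V ≤ U) : VF U →ₗ[ℝ] VF V where
  toFun X := mk' X (X.2.1.mono h)
  map_add' X Y := ext_on fun p hp => by
    change _ = mk' X _ p + mk' Y _ p
    rw [mk'_apply hp, mk'_apply hp, mk'_apply hp]; rfl
  map_smul' c X := ext_on fun p hp => by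
    change _ = c • mk' X _ p
    rw [mk'_apply hp, mk'_apply hp]; rfl

/-- `L` has dimension `n` as a space of *local* vector fields: its restriction to every nonempty
open subset of `U` has dimension `n`. If `U` is connected and the fields are real analytic, this
just says that `L` has dimension `n`. -/
def HasLocalDim (L : Submodule ℝ (VF U)) (n : ℕ) : Prop :=
  ∀ (V : Opens Plane) (h : V ≤ U), (V : Set Plane).Nonempty →
    Module.finrank ℝ (L.map (restrict h)) = n

/-- The commutator algebra `g' = [g, g]` as a subspace of the space of vector fields. -/
def commutatorOf (g : LieSubalgebra ℝ (VF U)) : Submodule ℝ (VF U) :=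
  (LieAlgebra.derivedSeries ℝ g 1).toSubmodule.map g.toSubmodule.subtype

/-- The centralizer `Z_A(w)` of `w` in `A`. -/
def centralizerIn (A : LieSubalgebra ℝ (VF U)) (w : VF U) : Submodule ℝ (VF U) where
  carrier := {X | X ∈ A ∧ ⁅X, w⁆ = 0}
  add_mem' := fun hX hY => ⟨add_mem hX.1 hY.1, by rw [add_lie, hX.2, hY.2, add_zero]⟩
  zero_mem' := ⟨zero_mem A, zero_lie w⟩
  smul_mem' := fun c X hX => ⟨A.smul_mem c hX.1, by rw [smul_lie, hX.2, smul_zero]⟩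

/-- The underlying set of functions of a space of vector fields. -/
def functions (L : Submodule ℝ (VF U)) : Set (Plane → Plane) := {f | ∃ X ∈ L, f = X}

/-- The vector field on `U` given by a smooth vector field on the whole plane. -/
def ofSmooth (U : Opens Plane) (f : Plane → Plane) (hf : ContDiff ℝ ∞ f) : VF U :=
  mk' f hf.contDiffOn

/-- The vector field `∂_x` on `U`. -/
def ddx (U : Opens Plane) : VF U := ofSmooth U (fun _ => (1, 0)) contDiff_const

/-- The vector field `∂_y` on `U`. -/
def ddy (U : Opens Plane) : VF U := ofSmooth U (fun _ => (0, 1)) contDiff_const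

/-- The vector field `y ∂_y` on `U`. -/
def yddy (U : Opens Plane) : VF U :=
  ofSmooth U (fun p => (0, p.2)) (contDiff_const.prodMk contDiff_snd)

/-- The vector field `exp (c x) ∂_y` on `U`. -/
def expddy (U : Opens Plane) (c : ℝ) : VF U :=
  ofSmooth U (fun p => (0, Real.exp (c * p.1)))
    (contDiff_const.prodMk (contDiff_const.mul contDiff_fst).exp)

end VF

/-! ### Orbits and rank -/

section Orbits

variable {V : Type*} [NormedAddCommGroup V] [NormedSpace ℝ V]

/-- `z'` is the time-one value of an integral curve in `Ω` of a field in `L` that starts at `z`. -/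
def FlowStep (Ω : Set V) (L : Set (V → V)) (z z' : V) : Prop :=
  ∃ X ∈ L, ∃ γ : ℝ → V, γ 0 = z ∧ γ 1 = z' ∧ (∀ t ∈ Icc (0 : ℝ) 1, γ t ∈ Ω) ∧
    IsIntegralCurveOn γ (fun _ => X) (Icc 0 1)

/-- The orbit of `z` under a linear space `L` of vector fields on `Ω`: the points reached from `z`
by following finitely many integral curves in `Ω` of fields in `L`. -/
def orbit (Ω : Set V) (L : Set (V → V)) (z : V) : Set V :=
  {z' | Relation.ReflTransGen (FlowStep Ω L) z z'}

/-- The dimension of the orbit of `z`. Orbits are immersed submanifolds with countable base, and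
for these the dimension is the Hausdorff dimension. -/
def orbitDim (Ω : Set V) (L : Set (V → V)) (z : V) : ℝ≥0∞ := dimH (orbit Ω L z)

/-- The rank: the dimension of the generic, that is highest-dimensional, orbits. -/
def orbitRank (Ω : Set V) (L : Set (V → V)) : ℝ≥0∞ := ⨆ z ∈ Ω, orbitDim Ω L z

/-- `S` is invariant if it is a union of orbits. -/
def IsOrbitInvariant (Ω : Set V) (L : Set (V → V)) (S : Set V) : Prop :=
  ∀ z ∈ S, orbit Ω L z ⊆ S

/-- `S` is a smooth (embedded) hypersurface in the open set `Ω`. -/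
def IsHypersurface (Ω S : Set V) : Prop :=
  S.Nonempty ∧ S ⊆ Ω ∧ ∀ z ∈ S, ∃ (N : Set V) (F : V → ℝ), IsOpen N ∧ z ∈ N ∧ N ⊆ Ω ∧
    ContDiffOn ℝ ∞ F N ∧ (∀ q ∈ N, fderiv ℝ F q ≠ 0) ∧ S ∩ N = {q ∈ N | F q = 0}

end Orbits

namespace VF

variable {U : Opens Plane}

/-- The dimension of the orbit in `U` through `p` of a Lie algebra of vector fields on `U`. -/
def orbDim (L : Submodule ℝ (VF U)) (p : Plane) : ℝ≥0∞ := orbitDim (U : Set Plane) (functions L) p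

/-- The rank of a Lie algebra of vector fields on `U`. -/
def rank (L : Submodule ℝ (VF U)) : ℝ≥0∞ := orbitRank (U : Set Plane) (functions L)

end VF

/-! ### Local coordinates -/

/-- Smooth coordinates on a connected open subset of `U`. -/
structure PlaneCoord (U : Opens Plane) where
  /-- The coordinate map. -/
  map : OpenPartialHomeomorph Plane Plane
  source_subset : map.source ⊆ U
  source_connected : IsConnected map.source
  contDiffOn_map : ContDiffOn ℝ ∞ map map.source
  contDiffOn_symm : ContDiffOn ℝ ∞ map.symm map.target

namespace PlaneCoord

variable {U : Opens Plane}

/-- The open set of coordinate values. -/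
def range (φ : PlaneCoord U) : Opens Plane := ⟨φ.map.target, φ.map.open_target⟩

theorem contDiffOn_push (φ : PlaneCoord U) (X : VF U) :
    ContDiffOn ℝ ∞ (fun q => fderiv ℝ φ.map (φ.map.symm q) (X (φ.map.symm q))) φ.range := by
  have hm : MapsTo φ.map.symm φ.map.target φ.map.source := φ.map.symm.mapsTo
  have h1 : ContDiffOn ℝ ∞ (fderiv ℝ φ.map) φ.map.source :=
    φ.contDiffOn_map.fderiv_of_isOpen φ.map.open_source (by simp)
  have h2 : ContDiffOn ℝ ∞ X φ.map.source := X.2.1.mono φ.source_subset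
  exact (h1.comp φ.contDiffOn_symm hm).clm_apply (h2.comp φ.contDiffOn_symm hm)

/-- The expression of a vector field in the coordinates `φ`, i.e. its push-forward
`q ↦ Dφ (X)` at `φ⁻¹ q`. -/
def push (φ : PlaneCoord U) : VF U →ₗ[ℝ] VF φ.range where
  toFun X := VF.mk' _ (φ.contDiffOn_push X)
  map_add' X Y := VF.ext_on fun p hp => by
    change _ = VF.mk' _ (φ.contDiffOn_push X) p + VF.mk' _ (φ.contDiffOn_push Y) p
    rw [VF.mk'_apply hp, VF.mk'_apply hp, VF.mk'_apply hp]
    exact map_add _ _ _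
  map_smul' c X := VF.ext_on fun p hp => by
    change _ = c • VF.mk' _ (φ.contDiffOn_push X) p
    rw [VF.mk'_apply hp, VF.mk'_apply hp]
    exact (fderiv ℝ φ.map (φ.map.symm p)).map_smul c (X (φ.map.symm p))

/-- The coordinates `(x, y + b)`, where `φ = (x, y)`. -/
def translateY (φ : PlaneCoord U) (b : ℝ) : PlaneCoord U where
  map := φ.map.transHomeomorph (Homeomorph.addRight ((0, b) : Plane))
  source_subset := φ.source_subset
  source_connected := φ.source_connected
  contDiffOn_map := φ.contDiffOn_map.add contDiffOn_const
  contDiffOn_symm := by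
    refine φ.contDiffOn_symm.comp (t := φ.map.target) (f := fun q : Plane => q + -(0, b)) ?_ ?_
    · exact (contDiff_id.add contDiff_const).contDiffOn
    · intro q hq
      exact hq

/-- Canonical coordinates for two vector fields: `e = ∂_x` and `w = ∂_y`. -/
def IsCanonical (φ : PlaneCoord U) (e w : VF U) : Prop :=
  φ.push e = VF.ddx φ.range ∧ φ.push w = VF.ddy φ.range

end PlaneCoord

/-! ### Prolongation to third-order jets -/

/-- The extended space with coordinates `(x, y, y', y'', y''')`, numbered from `0` to `4`. -/
abbrev Jet : Type := Fin 5 → ℝ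

/-- The part of the extended space over `W`. -/
def jetDomain (W : Opens Plane) : Set Jet := {z | (z 0, z 1) ∈ W}

/-- The total derivative `D_x = ∂_x + y' ∂_y + y'' ∂_{y'} + y''' ∂_{y''}`, for functions that do not
depend on `y'''`. -/
def totalD (f : Jet → ℝ) (z : Jet) : ℝ := fderiv ℝ f z ![1, z 2, z 3, z 4, 0]

/-- `ξ`, the coefficient of `∂_x` in `X = ξ ∂_x + η ∂_y`, on the extended space. -/
def xiCoeff (X : Plane → Plane) (z : Jet) : ℝ := (X (z 0, z 1)).1

/-- `η`, the coefficient of `∂_y` in `X = ξ ∂_x + η ∂_y`, on the extended space. -/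
def etaCoeff (X : Plane → Plane) (z : Jet) : ℝ := (X (z 0, z 1)).2

/-- The coefficient `η₁ = D_x η - y' D_x ξ` of `∂_{y'}` in the prolongation. -/
def eta1 (X : Plane → Plane) (z : Jet) : ℝ := totalD (etaCoeff X) z - z 2 * totalD (xiCoeff X) z

/-- The coefficient `η₂ = D_x η₁ - y'' D_x ξ` of `∂_{y''}` in the prolongation. -/
def eta2 (X : Plane → Plane) (z : Jet) : ℝ := totalD (eta1 X) z - z 3 * totalD (xiCoeff X) z

/-- The coefficient `η₃ = D_x η₂ - y''' D_x ξ` of `∂_{y'''}` in the prolongation. -/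
def eta3 (X : Plane → Plane) (z : Jet) : ℝ := totalD (eta2 X) z - z 4 * totalD (xiCoeff X) z

/-- The third prolongation of a plane vector field. -/
def prolong (X : Plane → Plane) (z : Jet) : Jet :=
  ![xiCoeff X z, etaCoeff X z, eta1 X z, eta2 X z, eta3 X z]

/-- The third prolongation of a Lie algebra of vector fields. -/
def prolongation {W : Opens Plane} (L : Submodule ℝ (VF W)) : Set (Jet → Jet) :=
  prolong '' VF.functions L

/-- The projection to `(x, y, y', y'')`. -/
def jetTrunc (z : Jet) : Fin 4 → ℝ := fun i => z i.castSucc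

/-- The equation `y''' = F(x, y, y', y'')`, with `F` defined on `D`, is invariant under `L`: the
prolonged fields are tangent to its graph. -/
def IsInvariantODE {W : Opens Plane} (L : Submodule ℝ (VF W)) (D : Set (Fin 4 → ℝ))
    (F : (Fin 4 → ℝ) → ℝ) : Prop :=
  ∀ Z ∈ prolongation L, ∀ z : Jet, jetTrunc z ∈ D → z 4 = F (jetTrunc z) →
    Z z 4 = fderiv ℝ F (jetTrunc z) (jetTrunc (Z z))

/-- The points over `W` that satisfy `y''' - (a + b) y'' + a b y' = 0`. -/
def odeLocus (W : Opens Plane) (a b : ℝ) : Set Jet :=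
  {z ∈ jetDomain W | z 4 - (a + b) * z 3 + a * b * z 2 = 0}

end

/-!
# Canonical form and invariant equation of a five-dimensional Lie algebra of plane vector fields

Since `k ≠ 0`, the centralizer of `w` in `A` is spanned by `e₁`, so the algebra of rank two is
spanned by the commuting fields `e₁` and `w`. Where these are dependent, a nontrivial combination
`Z` of them vanishes. As `Z` commutes with both fields, its values along their integral curves solve
a linear differential equation and stay zero, so the orbit is a piece of a single integral curve
and has dimension at most `1` (`VF.orbDim_le_one`). Where they are independent, the coframe dual to
`(e₁, w)` is closed, a primitive of it (Poincaré lemma) is a local diffeomorphism that straightens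
both fields (`exists_isCanonical`), and the orbit is open (`orbDim_eq_two_of_isCanonical`).

In canonical coordinates the brackets with `∂_x` and `∂_y` are partial derivatives. They give
`e₂ = a ∂_x + (c - k y) ∂_y` and `e₄ = e^{λx} C`, `e₅ = e^{μx} D` with constant vectors `C`, `D`, on
the whole domain as it is connected. The weight `k` of `e₄` and `e₅` under `e₂` then forces `a = 0`,
because `λ ≠ μ`, and makes `C`, `D` vertical (`VF.exists_canonical_form`). The translation of `y` by
`-c / k` brings `e₂` to a multiple of `y ∂_y`. Neither `e₄` nor `e₅` vanishes on a nonempty open set,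
as `g` has dimension five locally, and a count of dimensions shows that `w, e₄, e₅` span the commutator.

On jets, the linear form `ℓ = y''' - (λ + μ) y'' + λμ y'` is multiplied by `b` under the
prolongation of `a ∂_x + (b y + c + d e^{λx} + f e^{μx}) ∂_y`, and the last three fields span all
vertical directions in the kernel of `ℓ`. So the locus `ℓ = 0` is invariant, and over a square of the
base two jets whose values of `ℓ` differ by a positive factor, close enough to `1`, are joined by a
translation of `x`, a scaling and a vertical translation (`mem_orbit`). Thus orbits off the locus
are open, while over the connected base the locus is a single orbit. A hypersurface has empty
interior, so an invariant one lies in the locus and is all of it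
(`eq_odeLocus_of_isOrbitInvariant`). The statement on equations is the infinitesimal version: off the
locus the prolonged fields span every direction, in particular that of `y'''`
(`isInvariantODE_iff`).
-/

/-! ### Integral curves and one-dimensional orbits -/

section IntegralCurves

variable {E : Type*} [NormedAddCommGroup E] [NormedSpace ℝ E]

/-- Integral curves of a `C¹` field with the same starting point agree, since the field is Lipschitz
on the compact union of the two curves. -/
theorem IsIntegralCurveOn.eqOn_Icc {U : Set E} (hU : IsOpen U) {Y : E → E}
    (hY : ContDiffOn ℝ 1 Y U) {T : ℝ} {γ δ : ℝ → E}
    (hγ : IsIntegralCurveOn γ (fun _ => Y) (Icc 0 T)) (hγU : ∀ t ∈ Icc 0 T, γ t ∈ U)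
    (hδ : IsIntegralCurveOn δ (fun _ => Y) (Icc 0 T)) (hδU : ∀ t ∈ Icc 0 T, δ t ∈ U)
    (h0 : γ 0 = δ 0) : EqOn γ δ (Icc 0 T) := by
  set K : Set E := γ '' Icc 0 T ∪ δ '' Icc 0 T
  have hK : IsCompact K := (isCompact_Icc.image_of_continuousOn hγ.continuousOn).union
    (isCompact_Icc.image_of_continuousOn hδ.continuousOn)
  have hKU : K ⊆ U := by
    rintro _ (⟨t, ht, rfl⟩ | ⟨t, ht, rfl⟩)
    exacts [hγU t ht, hδU t ht]
  have hloc : LocallyLipschitzOn K Y := by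
    intro x hx
    obtain ⟨C, t, ht, hC⟩ :=
      (hY.contDiffAt (hU.mem_nhds (hKU hx))).exists_lipschitzOnWith
    exact ⟨C, t, mem_nhdsWithin_of_mem_nhds ht, hC⟩
  obtain ⟨C, hC⟩ := LocallyLipschitzOn.exists_lipschitzOnWith_of_compact hK hloc
  have key : ∀ {η : ℝ → E}, IsIntegralCurveOn η (fun _ => Y) (Icc 0 T) →
      ∀ t ∈ Ico 0 T, HasDerivWithinAt η (Y (η t)) (Ici t) t := fun {η} hη t ht =>
    (hη t ⟨ht.1, ht.2.le⟩).mono_of_mem_nhdsWithin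
      (mem_nhdsWithin.2
        ⟨Iio T, isOpen_Iio, ht.2, fun s hs => ⟨ht.1.trans hs.2, le_of_lt hs.1⟩⟩)
  exact ODE_solution_unique_of_mem_Icc_right (v := fun _ => Y) (s := fun _ => K)
    (fun _ _ => hC) hγ.continuousOn (key hγ)
    (fun t ht => Or.inl ⟨t, ⟨ht.1, ht.2.le⟩, rfl⟩) hδ.continuousOn (key hδ)
    (fun t ht => Or.inr ⟨t, ⟨ht.1, ht.2.le⟩, rfl⟩) h0

/-- `q` is reached from `p` in time `T ≥ 0` along an integral curve of `Y` in `U`. -/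
def ReachIn (U : Set E) (Y : E → E) (T : ℝ) (p q : E) : Prop :=
  0 ≤ T ∧ ∃ γ : ℝ → E, γ 0 = p ∧ γ T = q ∧ (∀ t ∈ Icc 0 T, γ t ∈ U) ∧
    IsIntegralCurveOn γ (fun _ => Y) (Icc 0 T)

namespace ReachIn

variable {U : Set E} {Y : E → E} {S T : ℝ} {p q r : E}

theorem unique (hU : IsOpen U) (hY : ContDiffOn ℝ 1 Y U) (h : ReachIn U Y T p q)
    (h' : ReachIn U Y T p r) : q = r := by
  obtain ⟨hT, γ, h0, h1, hγU, hγ⟩ := h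
  obtain ⟨-, δ, h0', h1', hδU, hδ⟩ := h'
  rw [← h1, ← h1']
  exact hγ.eqOn_Icc hU hY hγU hδ hδU (h0.trans h0'.symm) ⟨hT, le_rfl⟩

theorem reverse (h : ReachIn U Y T p q) : ReachIn U (-Y) T q p := by
  obtain ⟨hT, γ, h0, h1, hγU, hγ⟩ := h
  have hm : MapsTo (fun t : ℝ => T - t) (Icc 0 T) (Icc 0 T) :=
    fun t ht => ⟨by linarith [ht.2], by linarith [ht.1]⟩
  refine ⟨hT, fun t => γ (T - t), by simpa using h1, by simpa using h0,
    fun t ht => hγU _ (hm ht), fun t ht => ?_⟩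
  have := HasDerivWithinAt.scomp t (hγ (T - t) (hm ht))
    ((hasDerivAt_id t).const_sub T).hasDerivWithinAt hm
  simpa [Function.comp_def] using this

theorem truncate (h : ReachIn U Y T p q) (hS : 0 ≤ S) (hST : S ≤ T) :
    ∃ r, ReachIn U Y S p r ∧ ReachIn U Y (T - S) r q := by
  obtain ⟨hT, γ, h0, h1, hγU, hγ⟩ := h
  have hsub : Icc 0 S ⊆ Icc 0 T := Icc_subset_Icc le_rfl hST
  have hm : MapsTo (fun t : ℝ => t + S) (Icc 0 (T - S)) (Icc 0 T) :=
    fun t ht => ⟨by linarith [ht.1], by linarith [ht.2]⟩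
  refine ⟨γ S, ⟨hS, γ, h0, rfl, fun t ht => hγU t (hsub ht), hγ.mono hsub⟩, by linarith,
    fun t => γ (t + S), by simp, by simpa using h1, fun t ht => hγU _ (hm ht), fun t ht => ?_⟩
  have := HasDerivWithinAt.scomp t (hγ (t + S) (hm ht))
    ((hasDerivAt_id t).add_const S).hasDerivWithinAt hm
  simpa [Function.comp_def] using this

theorem trans (h : ReachIn U Y T p q) (h' : ReachIn U Y S q r) :
    ReachIn U Y (T + S) p r := by
  obtain ⟨hT, γ, h0, h1, hγU, hγ⟩ := h
  obtain ⟨hS, δ, h0', h1', hδU, hδ⟩ := h'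
  set η : ℝ → E := fun t => if t ≤ T then γ t else δ (t - T)
  have e1 : EqOn η γ (Icc 0 T) := fun t ht => if_pos ht.2
  have e2 : EqOn η (fun t => δ (t - T)) (Icc T (T + S)) := fun t ht => by
    rcases ht.1.eq_or_lt with rfl | h
    · simp [η, h1, h0']
    · exact if_neg h.not_ge
  have hm : MapsTo (fun t : ℝ => t - T) (Icc T (T + S)) (Icc 0 S) :=
    fun t ht => ⟨by linarith [ht.1], by linarith [ht.2]⟩
  have hU' : Icc 0 T ∪ Icc T (T + S) = Icc 0 (T + S) := Icc_union_Icc_eq_Icc hT (by linarith)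
  have d1 : ∀ t ∈ Icc 0 T, HasDerivWithinAt η (Y (η t)) (Icc 0 T) t := fun t ht => by
    rw [e1 ht]; exact (hγ t ht).congr e1 (e1 ht)
  have d2 : ∀ t ∈ Icc T (T + S), HasDerivWithinAt η (Y (η t)) (Icc T (T + S)) t := fun t ht => by
    rw [e2 ht]
    have := HasDerivWithinAt.scomp t (hδ (t - T) (hm ht))
      ((hasDerivAt_id t).sub_const T).hasDerivWithinAt hm
    exact HasDerivWithinAt.congr (by simpa [Function.comp_def] using this) e2 (e2 ht)
  refine ⟨by linarith, η, by rw [e1 ⟨le_rfl, hT⟩, h0], ?_, fun t ht => ?_, fun t ht => ?_⟩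
  · rw [e2 ⟨by linarith, le_rfl⟩]; simpa using h1'
  · rw [← hU'] at ht
    rcases ht with ht | ht
    · rw [e1 ht]; exact hγU t ht
    · rw [e2 ht]; exact hδU _ (hm ht)
  · rcases lt_trichotomy t T with h | rfl | h
    · refine (d1 t ⟨ht.1, h.le⟩).mono_of_mem_nhdsWithin ?_
      filter_upwards [self_mem_nhdsWithin, mem_nhdsWithin_of_mem_nhds (Iio_mem_nhds h)]
        with s hs hs' using ⟨hs.1, le_of_lt hs'⟩
    · rw [← hU']
      exact (d1 t ⟨hT, le_rfl⟩).union (d2 t ⟨le_rfl, by linarith⟩)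
    · refine (d2 t ⟨h.le, ht.2⟩).mono_of_mem_nhdsWithin ?_
      filter_upwards [self_mem_nhdsWithin, mem_nhdsWithin_of_mem_nhds (Ioi_mem_nhds h)]
        with s hs hs' using ⟨le_of_lt hs', hs.2⟩

/-- For `a ≥ 0`, following `a • Y` for time `1` amounts to following `Y` for time `a`. -/
theorem of_smul {a : ℝ} {γ : ℝ → E} (hγU : ∀ t ∈ Icc (0 : ℝ) 1, γ t ∈ U)
    (hγ : ∀ t ∈ Icc (0 : ℝ) 1, HasDerivWithinAt γ (a • Y (γ t)) (Icc 0 1) t) (ha : 0 ≤ a) :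
    ReachIn U Y a (γ 0) (γ 1) := by
  rcases ha.eq_or_lt with rfl | ha
  · have hc : γ 1 = γ 0 := (convex_Icc (0 : ℝ) 1).is_const_of_fderivWithin_eq_zero (𝕜 := ℝ)
      (fun t ht => (hγ t ht).differentiableWithinAt) (fun t ht => by
        have h := (hγ t ht).hasFDerivWithinAt.fderivWithin (uniqueDiffOn_Icc_zero_one t ht)
        rw [h]; ext; simp) ⟨zero_le_one, le_rfl⟩ ⟨le_rfl, zero_le_one⟩
    rw [hc]
    refine ⟨le_rfl, fun _ => γ 0, rfl, rfl, fun t _ => hγU 0 ⟨le_rfl, zero_le_one⟩, fun t ht => ?_⟩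
    have ht : t = 0 := le_antisymm ht.2 ht.1
    rw [ht, Icc_self]; exact HasFDerivWithinAt.of_subsingleton subsingleton_singleton
  · have hm : MapsTo (fun t : ℝ => t / a) (Icc 0 a) (Icc 0 1) :=
      fun t ht => ⟨div_nonneg ht.1 ha.le, (div_le_one ha).2 ht.2⟩
    refine ⟨ha.le, fun t => γ (t / a), by simp, by simp [ha.ne'], fun t ht => hγU _ (hm ht),
      fun t ht => ?_⟩
    have := HasDerivWithinAt.scomp t (hγ (t / a) (hm ht))
      ((hasDerivAt_id t).div_const a).hasDerivWithinAt hm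
    simpa [Function.comp_def, smul_smul, ha.ne'] using this

/-- By uniqueness the points reached from `p` form the image of a set of times under one map, which
is locally Lipschitz. -/
theorem dimH_setOf_le_one (hU : IsOpen U) (hY : ContDiffOn ℝ 1 Y U) (p : E) :
    dimH {q | ∃ T, ReachIn U Y T p q} ≤ 1 := by
  set I : Set ℝ := {T | ∃ q, ReachIn U Y T p q}
  choose! σ hσ using (show ∀ T ∈ I, ∃ q, ReachIn U Y T p q from fun _ h => h)
  have himg : {q | ∃ T, ReachIn U Y T p q} ⊆ σ '' I := by
    rintro q ⟨T, h⟩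
    exact ⟨T, ⟨q, h⟩, (hσ T ⟨q, h⟩).unique hU hY h⟩
  have hlip : ∀ T ∈ I, ∃ C, LipschitzOnWith C σ (Icc 0 T) := by
    rintro T ⟨q, hT, γ, h0, h1, hγU, hγ⟩
    have hc : ContinuousOn (fun t => Y (γ t)) (Icc 0 T) :=
      hY.continuousOn.comp hγ.continuousOn hγU
    obtain ⟨C, hC⟩ := isCompact_Icc.exists_bound_of_continuousOn hc
    have hl : LipschitzOnWith C.toNNReal γ (Icc 0 T) :=
      (convex_Icc 0 T).lipschitzOnWith_of_nnnorm_hasDerivWithin_le hγ fun t ht => by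
        rw [← NNReal.coe_le_coe]
        exact (hC t ht).trans (Real.le_coe_toNNReal C)
    suffices h : EqOn σ γ (Icc 0 T) from ⟨C.toNNReal, fun s hs t ht => by
      rw [h hs, h ht]; exact hl hs ht⟩
    intro t ht
    have hsub : Icc 0 t ⊆ Icc 0 T := Icc_subset_Icc le_rfl ht.2
    have : ReachIn U Y t p (γ t) :=
      ⟨ht.1, γ, h0, rfl, fun s hs => hγU s (hsub hs), hγ.mono hsub⟩
    exact (hσ t ⟨_, this⟩).unique hU hY this
  refine (dimH_mono himg).trans ?_
  have hI : dimH I ≤ 1 := Real.dimH_univ ▸ dimH_mono (subset_univ I)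
  refine (dimH_image_le_of_locally_lipschitzOn fun t ht => ?_).trans hI
  have hnn : ∀ s ∈ I, 0 ≤ s := fun s ⟨_, h⟩ => h.1
  by_cases hmax : ∃ T ∈ I, t < T
  · obtain ⟨T, hT, htT⟩ := hmax
    obtain ⟨C, hC⟩ := hlip T hT
    refine ⟨C, Icc 0 T, ?_, hC⟩
    filter_upwards [self_mem_nhdsWithin, mem_nhdsWithin_of_mem_nhds (Iio_mem_nhds htT)]
      with s hs hs' using ⟨hnn s hs, le_of_lt hs'⟩
  · push Not at hmax
    obtain ⟨C, hC⟩ := hlip t ht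
    refine ⟨C, Icc 0 t, ?_, hC⟩
    filter_upwards [self_mem_nhdsWithin] with s hs using ⟨hnn s hs, hmax s hs⟩

/-- Following `Y` and then `-Y` amounts to following one of them: by uniqueness the second curve
runs back along the first one, up to `p` and beyond it if it lasts long enough. -/
theorem signed_trans (hU : IsOpen U) (hY : ContDiffOn ℝ 1 Y U)
    (h : ReachIn U Y T p q) (h' : ReachIn U (-Y) S q r) :
    ∃ R, ReachIn U Y R p r ∨ ReachIn U (-Y) R p r := by
  rcases le_total S T with hST | hST
  · obtain ⟨r', h1, h2⟩ := h.reverse.truncate h'.1 hST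
    obtain rfl := h1.unique hU hY.neg h'
    exact ⟨T - S, Or.inl (by simpa using h2.reverse)⟩
  · obtain ⟨p', h1, h2⟩ := h'.truncate h.1 hST
    obtain rfl := h1.unique hU hY.neg h.reverse
    exact ⟨S - T, Or.inr h2⟩

end ReachIn

/-- If all fields of `L` are, along the orbit of `p`, multiples of a single field `Y` with constant
coefficients, then the orbit of `p` is a piece of an integral curve of `Y`. -/
theorem orbitDim_le_one {U : Set E} (hU : IsOpen U) {L : Set (E → E)} {Y : E → E} {p : E}
    (hp : p ∈ U) (hY : ContDiffOn ℝ 1 Y U)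
    (hL : ∀ X ∈ L, ∃ a : ℝ, ∀ γ : ℝ → E, γ 0 ∈ orbit U L p →
      (∀ t ∈ Icc (0 : ℝ) 1, γ t ∈ U) → IsIntegralCurveOn γ (fun _ => X) (Icc 0 1) →
      ∀ t ∈ Icc (0 : ℝ) 1, X (γ t) = a • Y (γ t)) :
    orbitDim U L p ≤ 1 := by
  have hsub : orbit U L p ⊆ {q | ∃ T, ReachIn U Y T p q} ∪ {q | ∃ T, ReachIn U (-Y) T p q} := by
    intro q hq
    change Relation.ReflTransGen _ _ _ at hq
    induction hq with
    | refl =>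
      exact Or.inl ⟨0, le_rfl, fun _ => p, rfl, rfl, fun _ _ => hp, fun t ht => by
        have ht : t = 0 := le_antisymm ht.2 ht.1
        rw [ht, Icc_self]; exact HasFDerivWithinAt.of_subsingleton subsingleton_singleton⟩
    | tail hq hstep ih =>
      obtain ⟨X, hX, γ, rfl, rfl, hγU, hγ⟩ := hstep
      obtain ⟨a, ha⟩ := hL X hX
      have hd : ∀ t ∈ Icc (0 : ℝ) 1, HasDerivWithinAt γ (a • Y (γ t)) (Icc 0 1) t :=
        fun t ht => ha γ hq hγU hγ t ht ▸ hγ t ht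
      have hstep : ∃ T, ReachIn U Y T (γ 0) (γ 1) ∨ ReachIn U (-Y) T (γ 0) (γ 1) := by
        rcases le_total 0 a with h | h
        · exact ⟨a, Or.inl (ReachIn.of_smul hγU hd h)⟩
        · refine ⟨-a, Or.inr (ReachIn.of_smul hγU (fun t ht => ?_) (neg_nonneg.2 h))⟩
          simpa using hd t ht
      have hcomb : ∀ {R : ℝ}, ReachIn U Y R p (γ 1) ∨ ReachIn U (-Y) R p (γ 1) →
          γ 1 ∈ {q | ∃ T, ReachIn U Y T p q} ∪ {q | ∃ T, ReachIn U (-Y) T p q} :=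
        fun h => h.imp (fun h => ⟨_, h⟩) (fun h => ⟨_, h⟩)
      obtain ⟨S, hS | hS⟩ := hstep <;> rcases ih with ⟨T, hT⟩ | ⟨T, hT⟩
      · exact Or.inl ⟨_, hT.trans hS⟩
      · obtain ⟨R, hR⟩ := hT.signed_trans hU (show ContDiffOn ℝ 1 (-Y) U from hY.neg)
          (by rwa [neg_neg])
        exact hcomb (by rw [neg_neg] at hR; exact hR.symm)
      · obtain ⟨R, hR⟩ := hT.signed_trans hU hY hS
        exact hcomb hR
      · exact Or.inr ⟨_, hT.trans hS⟩
  refine (dimH_mono hsub).trans ?_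
  rw [dimH_union]
  exact max_le (ReachIn.dimH_setOf_le_one hU hY p) (ReachIn.dimH_setOf_le_one hU hY.neg p)

theorem orbit_subset {Ω : Set E} {L : Set (E → E)} {S : Set E} {z : E} (hz : z ∈ S)
    (h : ∀ z ∈ S, ∀ z', FlowStep Ω L z z' → z' ∈ S) : orbit Ω L z ⊆ S := by
  intro z' hz'
  change Relation.ReflTransGen _ _ _ at hz'
  induction hz' with
  | refl => exact hz
  | tail _ hs ih => exact h _ ih _ hs

end IntegralCurves

/-! ### Commuting vector fields in the plane -/

namespace VF

variable {U : Opens Plane}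

theorem contDiffOn (X : VF U) {n : ℕ∞} : ContDiffOn ℝ n X U :=
  X.2.1.of_le (by exact_mod_cast le_top)

theorem add_apply (X Y : VF U) (p : Plane) : (X + Y) p = X p + Y p := rfl

theorem smul_apply (c : ℝ) (X : VF U) (p : Plane) : (c • X) p = c • X p := rfl

theorem ofSmooth_apply {f : Plane → Plane} {hf : ContDiff ℝ ∞ f} {p : Plane} (hp : p ∈ U) :
    ofSmooth U f hf p = f p := mk'_apply (hf := hf.contDiffOn) hp

theorem ddx_apply {p : Plane} (hp : p ∈ U) : ddx U p = (1, 0) := ofSmooth_apply hp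

theorem ddy_apply {p : Plane} (hp : p ∈ U) : ddy U p = (0, 1) := ofSmooth_apply hp

theorem yddy_apply {p : Plane} (hp : p ∈ U) : yddy U p = (0, p.2) := ofSmooth_apply hp

theorem expddy_apply {p : Plane} (c : ℝ) (hp : p ∈ U) :
    expddy U c p = (0, Real.exp (c * p.1)) := ofSmooth_apply hp

theorem bracket_apply' (X Y : VF U) {p : Plane} (hp : p ∈ U) :
    ⁅X, Y⁆ p = fderiv ℝ Y p (X p) - fderiv ℝ X p (Y p) := bracket_apply X Y hp

theorem fderiv_comm (X Y : VF U) (h : ⁅X, Y⁆ = 0) {p : Plane} (hp : p ∈ U) :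
    fderiv ℝ Y p (X p) = fderiv ℝ X p (Y p) := by
  rw [← sub_eq_zero, ← bracket_apply' X Y hp, h]; rfl

/-- The flow of `X` preserves every field `Z` that commutes with it: along an integral curve of `X`
the values of `Z` solve the linear equation `v' = DX(v)`. -/
theorem eq_zero_along {X Z : VF U} (h : ⁅X, Z⁆ = 0) {γ : ℝ → Plane}
    (hγU : ∀ t ∈ Icc (0 : ℝ) 1, γ t ∈ U) (hγ : IsIntegralCurveOn γ (fun _ => X) (Icc 0 1))
    (h0 : Z (γ 0) = 0) : ∀ t ∈ Icc (0 : ℝ) 1, Z (γ t) = 0 := by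
  have hc : ContinuousOn (fun t => fderiv ℝ X (γ t)) (Icc 0 1) :=
    (X.2.1.continuousOn_fderiv_of_isOpen U.isOpen (by simp)).comp hγ.continuousOn hγU
  obtain ⟨C, hC⟩ := isCompact_Icc.exists_bound_of_continuousOn hc
  have hd : ∀ t ∈ Icc (0 : ℝ) 1, HasDerivWithinAt (fun t => Z (γ t))
      (fderiv ℝ X (γ t) (Z (γ t))) (Icc 0 1) t := fun t ht => by
    rw [← fderiv_comm X Z h (hγU t ht)]
    exact (Z.differentiableAt (hγU t ht)).hasFDerivAt.comp_hasDerivWithinAt t (hγ t ht)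
  refine eq_zero_of_abs_deriv_le_mul_abs_self_of_eq_zero_right
    (fun t ht => (hd t ht).continuousWithinAt)
    (fun t ht => (hd t ⟨ht.1, ht.2.le⟩).mono_of_mem_nhdsWithin
      (mem_nhdsWithin.2 ⟨Iio 1, isOpen_Iio, ht.2, fun s hs => ⟨ht.1.trans hs.2, le_of_lt hs.1⟩⟩))
    h0 (fun t ht => ?_) (K := C)
  exact (ContinuousLinearMap.le_opNorm _ _).trans
    (mul_le_mul_of_nonneg_right (hC t ⟨ht.1, ht.2.le⟩) (norm_nonneg _))

/-- If `Z` commutes with `Y` and vanishes at `p`, it vanishes on the orbit of `p` under `⟨Y, Z⟩`,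
where only the flow of `Y` remains. -/
theorem orbDim_le_one_of_apply_eq_zero {Y Z : VF U} (h : ⁅Y, Z⁆ = 0) {L : Submodule ℝ (VF U)}
    (hL : ∀ X ∈ L, ∃ a b : ℝ, X = a • Y + b • Z) {p : Plane} (hp : p ∈ U) (hZ : Z p = 0) :
    orbDim L p ≤ 1 := by
  have hX : ∀ X ∈ L, ⁅X, Z⁆ = 0 := by
    intro X hX
    obtain ⟨a, b, rfl⟩ := hL X hX
    simp [h]
  have horb : orbit (U : Set Plane) (functions L) p ⊆ {z | Z z = 0} := by
    refine orbit_subset hZ ?_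
    rintro z hz z' ⟨_, ⟨X, hXL, rfl⟩, γ, rfl, rfl, hγU, hγ⟩
    exact eq_zero_along (hX X hXL) hγU hγ hz 1 ⟨zero_le_one, le_rfl⟩
  refine orbitDim_le_one U.isOpen hp (Y.contDiffOn (n := 1)) ?_
  rintro _ ⟨X, hXL, rfl⟩
  obtain ⟨a, b, hab⟩ := hL X hXL
  refine ⟨a, fun γ h0 hγU hγ t ht => ?_⟩
  have hz := eq_zero_along (hX X hXL) hγU hγ (horb h0) t ht
  rw [hab]
  change a • Y (γ t) + b • Z (γ t) = _
  rw [hz, smul_zero, add_zero]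

/-- Commuting fields that are dependent at `p` satisfy the same linear relation on the whole orbit
of `p`. -/
theorem orbDim_le_one {e w : VF U} (h : ⁅e, w⁆ = 0) {L : Submodule ℝ (VF U)}
    (hL : ∀ X ∈ L, ∃ a b : ℝ, X = a • e + b • w) {p : Plane} (hp : p ∈ U)
    (hdep : ¬ LinearIndependent ℝ ![e p, w p]) : orbDim L p ≤ 1 := by
  rw [LinearIndependent.pair_iff] at hdep
  push Not at hdep
  obtain ⟨s, t, hst, hne⟩ := hdep
  have h' : ⁅w, e⁆ = 0 := by rw [← lie_skew, h, neg_zero]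
  by_cases hs : s = 0
  · have ht := hne hs
    refine orbDim_le_one_of_apply_eq_zero (Y := e) (Z := w) h hL hp ?_
    simpa [hs, ht] using hst
  · refine orbDim_le_one_of_apply_eq_zero (Y := w) (Z := s • e + t • w) ?_ ?_ hp hst
    · simp [h']
    · intro X hX
      obtain ⟨a, b, rfl⟩ := hL X hX
      refine ⟨b - a / s * t, a / s, ?_⟩
      rw [smul_add, smul_smul, smul_smul, div_mul_cancel₀ _ hs, sub_smul]
      abel

end VF

namespace PlaneCoord

variable {U : Opens Plane} (φ : PlaneCoord U)

theorem contDiffAt_map {p : Plane} (hp : p ∈ φ.map.source) : ContDiffAt ℝ ∞ φ.map p :=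
  φ.contDiffOn_map.contDiffAt (φ.map.open_source.mem_nhds hp)

theorem contDiffAt_symm {q : Plane} (hq : q ∈ φ.range) : ContDiffAt ℝ ∞ φ.map.symm q :=
  φ.contDiffOn_symm.contDiffAt (φ.map.open_target.mem_nhds hq)

theorem symm_mem {q : Plane} (hq : q ∈ φ.range) : φ.map.symm q ∈ φ.map.source :=
  φ.map.map_target hq

theorem symm_mem' {q : Plane} (hq : q ∈ φ.range) : φ.map.symm q ∈ U :=
  φ.source_subset (φ.symm_mem hq)

theorem hasFDerivAt_symm {q : Plane} (hq : q ∈ φ.range) :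
    HasFDerivAt φ.map.symm (fderiv ℝ φ.map.symm q) q :=
  ((φ.contDiffAt_symm hq).differentiableAt (by simp)).hasFDerivAt

theorem hasFDerivAt_map {p : Plane} (hp : p ∈ φ.map.source) :
    HasFDerivAt φ.map (fderiv ℝ φ.map p) p :=
  ((φ.contDiffAt_map hp).differentiableAt (by simp)).hasFDerivAt

theorem fderiv_map_comp_symm {q : Plane} (hq : q ∈ φ.range) :
    (fderiv ℝ φ.map (φ.map.symm q)).comp (fderiv ℝ φ.map.symm q) = .id ℝ Plane := by
  refine ((φ.hasFDerivAt_map (φ.symm_mem hq)).comp q (φ.hasFDerivAt_symm hq)).unique ?_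
  refine (hasFDerivAt_id q).congr_of_eventuallyEq ?_
  filter_upwards [φ.map.open_target.mem_nhds hq] with r hr using φ.map.right_inv hr

theorem fderiv_symm_comp_map {q : Plane} (hq : q ∈ φ.range) :
    (fderiv ℝ φ.map.symm q).comp (fderiv ℝ φ.map (φ.map.symm q)) = .id ℝ Plane := by
  have h1 := φ.hasFDerivAt_symm hq
  rw [← φ.map.right_inv hq] at h1
  have h2 := h1.comp _ (φ.hasFDerivAt_map (φ.symm_mem hq))
  rw [φ.map.right_inv hq] at h2
  refine h2.unique ((hasFDerivAt_id _).congr_of_eventuallyEq ?_)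
  filter_upwards [φ.map.open_source.mem_nhds (φ.symm_mem hq)] with r hr using φ.map.left_inv hr

theorem push_apply (X : VF U) {q : Plane} (hq : q ∈ φ.range) :
    φ.push X q = fderiv ℝ φ.map (φ.map.symm q) (X (φ.map.symm q)) :=
  VF.mk'_apply (hf := φ.contDiffOn_push X) hq

theorem fderiv_symm_push (X : VF U) {q : Plane} (hq : q ∈ φ.range) :
    fderiv ℝ φ.map.symm q (φ.push X q) = X (φ.map.symm q) := by
  rw [push_apply φ X hq]
  exact DFunLike.congr_fun (φ.fderiv_symm_comp_map hq) _

theorem pullback_symm_eq (X : VF U) {q : Plane} (hq : q ∈ φ.range) :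
    pullback ℝ φ.map.symm X q = φ.push X q := by
  have : fderiv ℝ φ.map.symm q = (ContinuousLinearEquiv.equivOfInverse' _ _
    (φ.fderiv_symm_comp_map hq) (φ.fderiv_map_comp_symm hq) : Plane →L[ℝ] Plane) := rfl
  rw [push_apply φ X hq, pullback, this, ContinuousLinearMap.inverse_equiv]
  rfl

theorem push_lie (X Y : VF U) : φ.push ⁅X, Y⁆ = ⁅φ.push X, φ.push Y⁆ := by
  refine VF.ext_on fun q hq => ?_
  rw [VF.bracket_apply _ _ hq, ← pullback_symm_eq φ _ hq]
  have e : ∀ X : VF U, (φ.push X : Plane → Plane) =ᶠ[𝓝 q] pullback ℝ φ.map.symm X := fun X => by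
    filter_upwards [φ.range.isOpen.mem_nhds hq] with r hr using (φ.pullback_symm_eq X hr).symm
  rw [Filter.EventuallyEq.lieBracket_vectorField_eq (e X) (e Y),
    ← pullback_lieBracket (n := ∞)
      (by simpa using WithTop.coe_le_coe.2 (le_top : (2 : ℕ∞) ≤ ⊤)) (φ.contDiffAt_symm hq)
      (X.differentiableAt (φ.symm_mem' hq)) (Y.differentiableAt (φ.symm_mem' hq)), pullback,
    pullback, VF.bracket_apply _ _ (φ.symm_mem' hq)]

end PlaneCoord

/-- Commuting fields that are independent at `p` are coordinate fields near `p`. The coframe dual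
to `(e, w)` is closed since `e` and `w` commute, and a primitive of it is the coordinate map. -/
theorem exists_isCanonical {U : Opens Plane} {e w : VF U} (h : ⁅e, w⁆ = 0) {p : Plane} (hp : p ∈ U)
    (hind : LinearIndependent ℝ ![e p, w p]) :
    ∃ φ : PlaneCoord U, p ∈ φ.map.source ∧ φ.IsCanonical e w := by
  -- the frame `(e, w)` as a family of linear maps; its inverse `θ` is the dual coframe
  set M : Plane → Plane →L[ℝ] Plane := fun q =>
    (ContinuousLinearMap.fst ℝ ℝ ℝ).smulRight (e q) +
      (ContinuousLinearMap.snd ℝ ℝ ℝ).smulRight (w q)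
  have hM1 : ∀ q, M q (1, 0) = e q := fun q => by simp [M]
  have hM2 : ∀ q, M q (0, 1) = w q := fun q => by simp [M]
  have hMs : ContDiffOn ℝ ∞ M U :=
    ((ContinuousLinearMap.smulRightL ℝ Plane Plane
      (ContinuousLinearMap.fst ℝ ℝ ℝ)).contDiff.comp_contDiffOn e.2.1).add
    ((ContinuousLinearMap.smulRightL ℝ Plane Plane
      (ContinuousLinearMap.snd ℝ ℝ ℝ)).contDiff.comp_contDiffOn w.2.1)
  obtain ⟨M₀, hM₀⟩ : ∃ M₀ : Plane ≃L[ℝ] Plane, (M₀ : Plane →L[ℝ] Plane) = M p := by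
    have hinj : Function.Injective (M p).toLinearMap := by
      rw [← LinearMap.ker_eq_bot, LinearMap.ker_eq_bot']
      rintro ⟨a, b⟩ hab
      have := LinearIndependent.pair_iff.1 hind a b (by simpa [M] using hab)
      simp [this.1, this.2]
    refine ⟨(LinearEquiv.ofInjectiveEndo (M p).toLinearMap hinj).toContinuousLinearEquiv, ?_⟩
    ext <;> rfl
  obtain ⟨ε, hε, hB⟩ : ∃ ε > 0, Metric.ball p ε ⊆
      {q | q ∈ U ∧ ∃ N : Plane ≃L[ℝ] Plane, (N : Plane →L[ℝ] Plane) = M q} := by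
    refine Metric.mem_nhds_iff.1 (Filter.inter_mem (U.isOpen.mem_nhds hp) ?_)
    have hc : ContinuousAt M p := (hMs.continuousOn).continuousAt (U.isOpen.mem_nhds hp)
    exact hc.preimage_mem_nhds (hM₀ ▸ ContinuousLinearEquiv.nhds M₀)
  set B := Metric.ball p ε
  set θ : Plane → Plane →L[ℝ] Plane := fun q => (M q).inverse
  have hθM : ∀ q ∈ B, ∀ v, θ q (M q v) = v := fun q hq v => by
    obtain ⟨N, hN⟩ := (hB hq).2
    simp only [θ, ← hN, ContinuousLinearMap.inverse_equiv]
    exact N.symm_apply_apply v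
  have hMθ : ∀ q ∈ B, ∀ v, M q (θ q v) = v := fun q hq v => by
    obtain ⟨N, hN⟩ := (hB hq).2
    simp only [θ, ← hN, ContinuousLinearMap.inverse_equiv]
    exact N.apply_symm_apply v
  have hθs : ContDiffOn ℝ ∞ θ B := fun q hq => by
    obtain ⟨N, hN⟩ := (hB hq).2
    have h1 : ContDiffAt ℝ ∞ M q := hMs.contDiffAt (U.isOpen.mem_nhds (hB hq).1)
    have h2 : ContDiffAt ℝ ∞ ContinuousLinearMap.inverse (M q) := hN ▸ contDiffAt_map_inverse N
    exact (h2.comp q h1).contDiffWithinAt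
  have hθe : ∀ q ∈ B, θ q (e q) = (1, 0) := fun q hq => by rw [← hM1, hθM q hq]
  have hθw : ∀ q ∈ B, θ q (w q) = (0, 1) := fun q hq => by rw [← hM2, hθM q hq]
  -- the derivative of the constant function `θ (X)`, for `X = e` and `X = w`
  have key : ∀ (X : VF U) (c : Plane), (∀ q ∈ B, θ q (X q) = c) → ∀ q ∈ B, ∀ u,
      fderiv ℝ θ q u (X q) = - θ q (fderiv ℝ X q u) := fun X c hX q hq u => by
    have h1 : HasFDerivAt θ (fderiv ℝ θ q) q :=
      ((hθs.contDiffAt (Metric.isOpen_ball.mem_nhds hq)).differentiableAt (by simp)).hasFDerivAt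
    have h2 := h1.clm_apply (X.differentiableAt (hB hq).1).hasFDerivAt
    have h3 : HasFDerivAt (fun q => θ q (X q)) (0 : Plane →L[ℝ] Plane) q :=
      (hasFDerivAt_const c q).congr_of_eventuallyEq (by
        filter_upwards [Metric.isOpen_ball.mem_nhds hq] with r hr using hX r hr)
    have h4 := DFunLike.congr_fun (h2.unique h3) u
    simp at h4
    exact eq_neg_of_add_eq_zero_right h4
  -- `θ` is closed: both sides are bilinear, and they agree on the frame since `[e, w] = 0`
  have hsymm : ∀ q ∈ B, ∀ x y, fderiv ℝ θ q x y = fderiv ℝ θ q y x := by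
    intro q hq x y
    have hew : fderiv ℝ θ q (e q) (w q) = fderiv ℝ θ q (w q) (e q) := by
      rw [key w _ hθw q hq, key e _ hθe q hq, VF.fderiv_comm e w h (hB hq).1]
    have hM : ∀ v, M q v = v.1 • e q + v.2 • w q := fun v => rfl
    rw [← hMθ q hq x, ← hMθ q hq y, hM, hM]
    simp only [map_add, map_smul, add_apply, smul_apply, hew,
      smul_add, smul_smul]
    rw [mul_comm (θ q y).1 (θ q x).1, mul_comm (θ q y).1 (θ q x).2, mul_comm (θ q y).2 (θ q x).1,
      mul_comm (θ q y).2 (θ q x).2]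
    abel
  obtain ⟨f, hf⟩ := (convex_ball p ε).exists_forall_hasFDerivAt_of_fderiv_symmetric
    Metric.isOpen_ball (hθs.differentiableOn (by simp)) hsymm
  have hfs : ContDiffOn ℝ ∞ f B := by
    rw [contDiffOn_infty_iff_fderiv_of_isOpen Metric.isOpen_ball]
    exact ⟨fun q hq => (hf q hq).differentiableAt.differentiableWithinAt,
      hθs.congr fun q hq => (hf q hq).fderiv⟩
  have hpB : p ∈ B := Metric.mem_ball_self hε
  have hder : ∀ q ∈ B, ∃ N : Plane ≃L[ℝ] Plane, HasFDerivAt f (N : Plane →L[ℝ] Plane) q := by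
    intro q hq
    obtain ⟨N, hN⟩ := (hB hq).2
    refine ⟨N.symm, ?_⟩
    have := hf q hq
    simpa only [θ, ← hN, ContinuousLinearMap.inverse_equiv] using this
  obtain ⟨N, hN⟩ := hder p hpB
  have hfp : ContDiffAt ℝ ∞ f p := hfs.contDiffAt (Metric.isOpen_ball.mem_nhds hpB)
  set F := hfp.toOpenPartialHomeomorph f hN (by simp)
  have hpF : p ∈ F.source := hfp.mem_toOpenPartialHomeomorph_source hN (by simp)
  -- restriction to a ball makes the domain of the coordinates connected
  obtain ⟨r, hr, hrB⟩ := Metric.mem_nhds_iff.1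
    (Filter.inter_mem (F.open_source.mem_nhds hpF) (Metric.isOpen_ball.mem_nhds hpB))
  set G := F.restrOpen (Metric.ball p r) Metric.isOpen_ball
  have hGs : G.source = Metric.ball p r := by
    change F.source ∩ Metric.ball p r = _
    exact inter_eq_right.2 fun q hq => (hrB hq).1
  have hGB : G.source ⊆ B := fun q hq => (hrB (hGs ▸ hq)).2
  have hGf : (G : Plane → Plane) = f := rfl
  refine ⟨⟨G, fun q hq => (hB (hGB hq)).1, ?_, hfs.mono hGB, ?_⟩, ?_, ?_, ?_⟩
  · rw [hGs]
    exact ⟨⟨p, Metric.mem_ball_self hr⟩, (convex_ball p r).isPreconnected⟩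
  · intro q hq
    have hq' := hGB (G.map_target hq)
    obtain ⟨N', hN'⟩ := hder _ hq'
    exact (G.contDiffAt_symm hq hN'
      (hfs.contDiffAt (Metric.isOpen_ball.mem_nhds hq'))).contDiffWithinAt
  · rw [hGs]; exact Metric.mem_ball_self hr
  · refine VF.ext_on fun q hq => ?_
    have hq' := hGB (G.map_target hq)
    rw [PlaneCoord.push_apply _ _ hq, VF.ddx_apply hq]
    change fderiv ℝ f (G.symm q) (e (G.symm q)) = _
    rw [(hf _ hq').fderiv, hθe _ hq']
  · refine VF.ext_on fun q hq => ?_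
    have hq' := hGB (G.map_target hq)
    rw [PlaneCoord.push_apply _ _ hq, VF.ddy_apply hq]
    change fderiv ℝ f (G.symm q) (w (G.symm q)) = _
    rw [(hf _ hq').fderiv, hθw _ hq']

/-- In canonical coordinates the flows are translations, so orbits are open there. -/
theorem orbDim_eq_two_of_isCanonical {U : Opens Plane} {e w : VF U} {L : Submodule ℝ (VF U)}
    (he : e ∈ L) (hw : w ∈ L) {φ : PlaneCoord U} (hφ : φ.IsCanonical e w) {p : Plane}
    (hp : p ∈ φ.map.source) : VF.orbDim L p = 2 := by
  have hpt : φ.map p ∈ φ.map.target := φ.map.map_source hp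
  obtain ⟨ε, hε, hB⟩ := Metric.mem_nhds_iff.1 (φ.map.open_target.mem_nhds hpt)
  have hmem : φ.map.source ∩ φ.map ⁻¹' Metric.ball (φ.map p) ε ∈ 𝓝 p :=
    (φ.map.isOpen_inter_preimage Metric.isOpen_ball).mem_nhds ⟨hp, Metric.mem_ball_self hε⟩
  have hsub : φ.map.source ∩ φ.map ⁻¹' Metric.ball (φ.map p) ε ⊆
      orbit (U : Set Plane) (VF.functions L) p := by
    rintro q ⟨hq, hqB⟩
    set v := φ.map q - φ.map p
    have hline : ∀ t ∈ Icc (0 : ℝ) 1, φ.map p + t • v ∈ φ.range := fun t ht =>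
      hB ((convex_ball _ _).add_smul_sub_mem (Metric.mem_ball_self hε) hqB ht)
    refine Relation.ReflTransGen.single ⟨_, ⟨v.1 • e + v.2 • w,
      L.add_mem (L.smul_mem _ he) (L.smul_mem _ hw), rfl⟩,
      fun t => φ.map.symm (φ.map p + t • v), ?_, ?_, fun t ht => φ.symm_mem' (hline t ht),
      fun t ht => ?_⟩
    · simp [φ.map.left_inv hp]
    · simp [v, φ.map.left_inv hq]
    · have h1 : HasDerivAt (fun t : ℝ => φ.map p + t • v) v t := by
        simpa using ((hasDerivAt_id t).smul_const v).const_add (φ.map p)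
      have h2 := (φ.hasFDerivAt_symm (hline t ht)).comp_hasDerivAt t h1
      have h3 : fderiv ℝ φ.map.symm (φ.map p + t • v) v =
          (v.1 • e + v.2 • w : VF U) (φ.map.symm (φ.map p + t • v)) := by
        rw [← φ.fderiv_symm_push _ (hline t ht), map_add, map_smul, map_smul, hφ.1, hφ.2]
        congr 1
        rw [VF.add_apply, VF.smul_apply, VF.smul_apply, VF.ddx_apply (hline t ht),
          VF.ddy_apply (hline t ht)]
        simp
      rw [h3] at h2
      exact h2.hasDerivWithinAt
  change dimH _ = 2
  rw [Real.dimH_of_mem_nhds (Filter.mem_of_superset hmem hsub)]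
  simp

/-! ### The canonical form of the algebra -/

namespace VF

variable {W : Opens Plane}

theorem eq_of_hasFDerivAt_zero (hW : IsPreconnected (W : Set Plane)) {f : Plane → Plane}
    (hf : ∀ q ∈ W, HasFDerivAt f (0 : Plane →L[ℝ] Plane) q) : ∃ c, ∀ q ∈ W, f q = c :=
  W.isOpen.exists_is_const_of_fderiv_eq_zero hW
    (fun q hq => (hf q hq).differentiableAt.differentiableWithinAt) (fun q hq => (hf q hq).fderiv)

theorem fderiv_ddx {q : Plane} (hq : q ∈ W) : fderiv ℝ (ddx W) q = 0 := by
  rw [ddx, ofSmooth, (mk'_eventuallyEq hq).fderiv_eq, fderiv_const_apply]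

theorem fderiv_ddy {q : Plane} (hq : q ∈ W) : fderiv ℝ (ddy W) q = 0 := by
  rw [ddy, ofSmooth, (mk'_eventuallyEq hq).fderiv_eq, fderiv_const_apply]

theorem ddx_lie_apply (X : VF W) {q : Plane} (hq : q ∈ W) :
    ⁅ddx W, X⁆ q = fderiv ℝ X q (1, 0) := by
  rw [bracket_apply' _ _ hq, fderiv_ddx hq, ddx_apply hq]; simp

theorem ddy_lie_apply (X : VF W) {q : Plane} (hq : q ∈ W) :
    ⁅ddy W, X⁆ q = fderiv ℝ X q (0, 1) := by
  rw [bracket_apply' _ _ hq, fderiv_ddy hq, ddy_apply hq]; simp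

theorem fderiv_apply_eq (X : VF W) {q : Plane} (hq : q ∈ W) (v : Plane) :
    fderiv ℝ X q v = v.1 • ⁅ddx W, X⁆ q + v.2 • ⁅ddy W, X⁆ q := by
  rw [ddx_lie_apply X hq, ddy_lie_apply X hq, ← map_smul, ← map_smul, ← map_add]
  congr 1; simp

/-- A field that commutes with `∂_x` and whose bracket with `∂_y` is `k ∂_y` has a constant
`∂_x`-component and a `∂_y`-component that is affine in `y`. -/
theorem exists_affine_form (hW : IsPreconnected (W : Set Plane)) {X : VF W} {k : ℝ}
    (hx : ⁅ddx W, X⁆ = 0) (hy : ⁅X, ddy W⁆ = k • ddy W) :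
    ∃ a c : ℝ, ∀ q ∈ W, X q = (a, c - k * q.2) := by
  obtain ⟨c, hc⟩ := eq_of_hasFDerivAt_zero hW (f := fun q => X q + (0, k * q.2)) (fun q hq => by
    have h1 : HasFDerivAt (fun q : Plane => ((0 : ℝ), k * q.2))
        ((0 : Plane →L[ℝ] ℝ).prod (k • ContinuousLinearMap.snd ℝ ℝ ℝ)) q :=
      (hasFDerivAt_const _ _).prodMk (hasFDerivAt_snd.const_mul k)
    have h2 := (X.differentiableAt hq).hasFDerivAt.add h1
    refine h2.congr_fderiv (ContinuousLinearMap.ext fun v => ?_)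
    have hy' : ⁅ddy W, X⁆ = -(k • ddy W) := by rw [← lie_skew, hy]
    change fderiv ℝ X q v + (0, k * v.2) = 0
    rw [fderiv_apply_eq X hq, hx, hy']
    change v.1 • (0 : Plane) + v.2 • -(k • ddy W q) + _ = _
    rw [ddy_apply hq]
    ext <;> simp [mul_comm])
  exact ⟨c.1, c.2, fun q hq => by rw [eq_sub_of_add_eq (hc q hq)]; ext <;> simp⟩

/-- A field of `∂_x`-weight `l` that commutes with `∂_y` is `e^{lx}` times a constant field. -/
theorem exists_exp_form (hW : IsPreconnected (W : Set Plane)) {Y : VF W} {l : ℝ}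
    (hx : ⁅ddx W, Y⁆ = l • Y) (hy : ⁅ddy W, Y⁆ = 0) :
    ∃ c : Plane, ∀ q ∈ W, Y q = Real.exp (l * q.1) • c := by
  obtain ⟨c, hc⟩ := eq_of_hasFDerivAt_zero hW (f := fun q => Real.exp (-(l * q.1)) • Y q)
    (fun q hq => by
      have h1 : HasFDerivAt (fun q : Plane => Real.exp (-(l * q.1)))
          (Real.exp (-(l * q.1)) • -(l • ContinuousLinearMap.fst ℝ ℝ ℝ)) q :=
        ((hasFDerivAt_fst.const_mul l).neg).exp
      have h2 := h1.smul (Y.differentiableAt hq).hasFDerivAt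
      refine h2.congr_fderiv (ContinuousLinearMap.ext fun v => ?_)
      change Real.exp (-(l * q.1)) • fderiv ℝ Y q v +
        (Real.exp (-(l * q.1)) • -(l • v.1)) • Y q = 0
      rw [fderiv_apply_eq Y hq, hx, hy]
      change Real.exp (-(l * q.1)) • (v.1 • l • Y q + v.2 • (0 : Plane)) + _ = _
      rw [smul_zero, add_zero, smul_smul, smul_smul, ← add_smul]
      convert zero_smul ℝ (Y q) using 2
      simp; ring)
  refine ⟨c, fun q hq => ?_⟩
  rw [← hc q hq, smul_smul, ← Real.exp_add]; simp

/-- A field `X = a ∂_x + (c - k y) ∂_y` for which two nonzero fields with different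
`∂_x`-weights have the weight `k` is vertical, and so are these fields. -/
theorem exists_canonical_form (hW : IsConnected (W : Set Plane)) {X Y Z : VF W} {k l m : ℝ}
    (hk : k ≠ 0) (hl : l ≠ 0) (hm : m ≠ 0) (hlm : l ≠ m) (hXx : ⁅ddx W, X⁆ = 0)
    (hXy : ⁅X, ddy W⁆ = k • ddy W) (hYx : ⁅ddx W, Y⁆ = l • Y) (hYy : ⁅ddy W, Y⁆ = 0)
    (hXY : ⁅X, Y⁆ = k • Y) (hY : Y ≠ 0) (hZx : ⁅ddx W, Z⁆ = m • Z) (hZy : ⁅ddy W, Z⁆ = 0)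
    (hXZ : ⁅X, Z⁆ = k • Z) (hZ : Z ≠ 0) :
    (∃ c : ℝ, ∀ q ∈ W, X q = (0, c - k * q.2)) ∧
      (∃ d : ℝ, d ≠ 0 ∧ Y = d • expddy W l) ∧ ∃ d : ℝ, d ≠ 0 ∧ Z = d • expddy W m := by
  obtain ⟨a, c, hX⟩ := exists_affine_form hW.isPreconnected hXx hXy
  have key : ∀ {T : VF W} {n : ℝ}, ⁅ddx W, T⁆ = n • T → ⁅ddy W, T⁆ = 0 → ⁅X, T⁆ = k • T →
      T ≠ 0 → ∃ C : Plane, (∀ q ∈ W, T q = Real.exp (n * q.1) • C) ∧ C ≠ 0 ∧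
        n * a * C.1 = k * C.1 ∧ n * a * C.2 = 0 := by
    intro T n hTx hTy hXT hT
    obtain ⟨C, hC⟩ := exists_exp_form hW.isPreconnected hTx hTy
    refine ⟨C, hC, ?_, ?_⟩
    · rintro rfl
      exact hT (ext_on fun q hq => by rw [hC q hq, smul_zero]; rfl)
    obtain ⟨q, hq⟩ := hW.nonempty
    have h1 : ⁅X, T⁆ q = k • T q := by rw [hXT]; rfl
    have hXy' : ⁅ddy W, X⁆ = -(k • ddy W) := by rw [← lie_skew, hXy]
    rw [bracket_apply' _ _ hq, fderiv_apply_eq T hq, fderiv_apply_eq X hq, hTx, hTy, hXx, hXy'] at h1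
    change (X q).1 • n • T q + (X q).2 • (0 : Plane) -
      ((T q).1 • (0 : Plane) + (T q).2 • -(k • ddy W q)) = _ at h1
    rw [ddy_apply hq, hX q hq, hC q hq] at h1
    have e0 : Real.exp (n * q.1) ≠ 0 := (Real.exp_pos _).ne'
    have h2 := congrArg Prod.fst h1
    have h3 := congrArg Prod.snd h1
    simp at h2 h3
    constructor
    · apply mul_left_cancel₀ e0; linarith
    · apply mul_left_cancel₀ e0; linarith
  obtain ⟨C, hYC, hC0, hC1, hC2⟩ := key hYx hYy hXY hY
  obtain ⟨D, hZD, hD0, hD1, hD2⟩ := key hZx hZy hXZ hZ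
  have hne : ∀ C : Plane, C ≠ 0 → C.2 = 0 → C.1 ≠ 0 := fun C h h2 h1 => h (Prod.ext h1 h2)
  -- for `a ≠ 0` both fields would be horizontal, with `l a = k = m a`
  have ha : a = 0 := by
    by_contra ha
    have hC2' : C.2 = 0 := by simpa [hl, ha] using hC2
    have hD2' : D.2 = 0 := by simpa [hm, ha] using hD2
    have h1 := mul_right_cancel₀ (hne C hC0 hC2') hC1
    have h2 := mul_right_cancel₀ (hne D hD0 hD2') hD1
    exact hlm (mul_right_cancel₀ ha (h1.trans h2.symm))
  subst ha
  have hform : ∀ {T : VF W} {n : ℝ} {C : Plane}, C ≠ 0 → n * 0 * C.1 = k * C.1 →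
      (∀ q ∈ W, T q = Real.exp (n * q.1) • C) → ∃ d : ℝ, d ≠ 0 ∧ T = d • expddy W n := by
    intro T n C hC0 hC1 hT
    have h1 : C.1 = 0 := by simpa [hk] using hC1.symm
    refine ⟨C.2, fun h2 => hC0 (Prod.ext h1 h2), ext_on fun q hq => ?_⟩
    rw [hT q hq, smul_apply, expddy_apply _ hq]
    ext <;> simp [h1, mul_comm]
  exact ⟨⟨c, hX⟩, hform hC0 hC1 hYC, hform hD0 hD1 hZD⟩

theorem restrict_apply {U V : Opens Plane} (h : V ≤ U) (X : VF U) {p : Plane} (hp : p ∈ V) :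
    restrict h X p = X p := mk'_apply (hf := X.2.1.mono h) hp

theorem finrank_eq_of_hasLocalDim {U : Opens Plane} (hU : (U : Set Plane).Nonempty)
    {L : Submodule ℝ (VF U)} {n : ℕ} (h : HasLocalDim L n) : Module.finrank ℝ L = n := by
  rw [← h U le_rfl hU]
  refine (LinearEquiv.finrank_eq (Submodule.equivMapOfInjective _ (fun X Y hXY => ?_) L))
  refine ext_on fun p hp => ?_
  rw [← restrict_apply le_rfl X hp, ← restrict_apply le_rfl Y hp, hXY]

/-- If a space of fields keeps its dimension on `V`, no nonzero field of it vanishes on `V`. -/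
theorem eq_zero_of_restrict_eq_zero {U V : Opens Plane} (hVU : V ≤ U)
    (hV : (V : Set Plane).Nonempty) {L : Submodule ℝ (VF U)} {n : ℕ} (hn : n ≠ 0)
    (h : HasLocalDim L n) {X : VF U} (hX : X ∈ L) (h0 : restrict hVU X = 0) : X = 0 := by
  have hL := finrank_eq_of_hasLocalDim (hV.mono hVU) h
  have : FiniteDimensional ℝ L := Module.finite_of_finrank_pos (by omega)
  have : FiniteDimensional ℝ (L.map (restrict hVU)) :=
    Module.finite_of_finrank_pos (by rw [h V hVU hV]; omega)
  have hinj : Function.Injective ((restrict hVU).submoduleMap L) :=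
    (LinearMap.injective_iff_surjective_of_finrank_eq_finrank (hL.trans (h V hVU hV).symm)).2
      ((restrict hVU).submoduleMap_surjective L)
  have : (⟨X, hX⟩ : L) = 0 := hinj (Subtype.ext (by simpa using h0))
  exact congrArg Subtype.val this

theorem push_ne_zero {U : Opens Plane} (φ : PlaneCoord U) {L : Submodule ℝ (VF U)} {n : ℕ}
    (hn : n ≠ 0) (h : HasLocalDim L n) {X : VF U} (hX : X ∈ L) (h0 : X ≠ 0) : φ.push X ≠ 0 := by
  intro hp
  refine h0 (eq_zero_of_restrict_eq_zero (V := ⟨φ.map.source, φ.map.open_source⟩)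
    φ.source_subset φ.source_connected.nonempty hn h hX (ext_on fun p hps => ?_))
  have hq : φ.map p ∈ φ.range := φ.map.map_source hps
  have h1 := φ.fderiv_symm_push X hq
  rw [hp, φ.map.left_inv hps] at h1
  exact (restrict_apply φ.source_subset X hps).trans (h1.symm.trans (map_zero _))

theorem lie_eq_zero_of_mem_commutatorOf {U : Opens Plane} {g : LieSubalgebra ℝ (VF U)}
    (hab : IsLieAbelian (LieAlgebra.derivedSeries ℝ g 1)) {X Y : VF U}
    (hX : X ∈ commutatorOf g) (hY : Y ∈ commutatorOf g) : ⁅X, Y⁆ = 0 := by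
  obtain ⟨X, hX, rfl⟩ := hX
  obtain ⟨Y, hY, rfl⟩ := hY
  have h := hab.trivial ⟨X, hX⟩ ⟨Y, hY⟩
  exact congrArg (fun Z : LieAlgebra.derivedSeries ℝ g 1 => ((Z : g) : VF U)) h

theorem lie_eq_zero_of_mem {U : Opens Plane} {A : LieSubalgebra ℝ (VF U)} (hA : IsLieAbelian A)
    {X Y : VF U} (hX : X ∈ A) (hY : Y ∈ A) : ⁅X, Y⁆ = 0 :=
  congrArg (fun Z : A => (Z : VF U)) (hA.trivial ⟨X, hX⟩ ⟨Y, hY⟩)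

/-- Weight vectors of different weights are independent, so three of them span the
three-dimensional commutator. -/
theorem commutatorOf_eq_span {U : Opens Plane} {g A : LieSubalgebra ℝ (VF U)}
    (hg : Module.finrank ℝ g.toSubmodule = 5)
    (hsup : A.toSubmodule ⊔ commutatorOf g = g.toSubmodule)
    (hdisj : Disjoint A.toSubmodule (commutatorOf g)) {e₁ e₂ w e₄ e₅ : VF U}
    (hbasis : LinearIndependent ℝ ![e₁, e₂]) (hspan : A.toSubmodule = Submodule.span ℝ {e₁, e₂})
    (hw : w ∈ commutatorOf g) (h₄ : e₄ ∈ commutatorOf g) (h₅ : e₅ ∈ commutatorOf g)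
    (hw0 : w ≠ 0) (h₄0 : e₄ ≠ 0) (h₅0 : e₅ ≠ 0) {l m : ℝ} (hl : l ≠ 0) (hm : m ≠ 0) (hlm : l ≠ m)
    (hw1 : ⁅e₁, w⁆ = (0 : ℝ) • w) (h₄1 : ⁅e₁, e₄⁆ = l • e₄) (h₅1 : ⁅e₁, e₅⁆ = m • e₅) :
    commutatorOf g = Submodule.span ℝ {w, e₄, e₅} := by
  have hgf : FiniteDimensional ℝ g.toSubmodule := Module.finite_of_finrank_pos (by omega)
  have hAf : FiniteDimensional ℝ A.toSubmodule :=
    Submodule.finiteDimensional_of_le (hsup ▸ le_sup_left)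
  have hCf : FiniteDimensional ℝ (commutatorOf g) :=
    Submodule.finiteDimensional_of_le (hsup ▸ le_sup_right)
  have hA2 : Module.finrank ℝ A.toSubmodule = 2 := by
    have h := finrank_span_eq_card hbasis
    have hr : Set.range ![e₁, e₂] = {e₁, e₂} := by
      ext; simp [eq_comm, or_comm]
    rw [hspan, ← hr, h]; rfl
  have hC3 : Module.finrank ℝ (commutatorOf g) = 3 := by
    have h := Submodule.finrank_sup_add_finrank_inf_eq A.toSubmodule (commutatorOf g)
    rw [hsup, hdisj.eq_bot, finrank_bot, hg, hA2] at h
    omega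
  have hli : LinearIndependent ℝ ![w, e₄, e₅] := by
    refine Module.End.eigenvectors_linearIndependent' (LieAlgebra.ad ℝ (VF U) e₁) ![0, l, m] ?_ _ ?_
    · intro i j hij
      fin_cases i <;> fin_cases j <;> simp_all
    · intro i
      fin_cases i
      · exact ⟨Module.End.mem_eigenspace_iff.2 hw1, hw0⟩
      · exact ⟨Module.End.mem_eigenspace_iff.2 h₄1, h₄0⟩
      · exact ⟨Module.End.mem_eigenspace_iff.2 h₅1, h₅0⟩
  have hr : Set.range ![w, e₄, e₅] = {w, e₄, e₅} := by
    ext; simp [eq_comm]; tauto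
  refine (Submodule.eq_of_le_of_finrank_eq (Submodule.span_le.2 ?_) ?_).symm
  · rintro _ (rfl | rfl | rfl) <;> assumption
  · rw [hC3, ← hr, finrank_span_eq_card hli]; rfl

/-- The fields `a ∂_x + b y ∂_y` are told apart from those of the second span by the `∂_x`-component
and by the dependence on `y`. -/
theorem disjoint_canonical {W : Opens Plane} (hW : (W : Set Plane).Nonempty) (l m : ℝ) :
    Disjoint (Submodule.span ℝ {ddx W, yddy W})
      (Submodule.span ℝ {ddy W, expddy W l, expddy W m}) := by
  rw [Submodule.disjoint_def]
  intro X h1 h2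
  obtain ⟨a, b, rfl⟩ := Submodule.mem_span_pair.1 h1
  obtain ⟨c, d, f, h⟩ := Submodule.mem_span_triple.1 h2
  have key : ∀ q ∈ W, a = 0 ∧ b * q.2 = c + d * Real.exp (l * q.1) + f * Real.exp (m * q.1) := by
    intro q hq
    have h3 := congrArg (fun Z : VF W => Z q) h
    simp only [VF.add_apply, VF.smul_apply, ddx_apply hq, ddy_apply hq, yddy_apply hq,
      expddy_apply _ hq] at h3
    have h4 := congrArg Prod.fst h3
    have h5 := congrArg Prod.snd h3
    simp at h4 h5
    exact ⟨h4.symm, h5.symm⟩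
  obtain ⟨q, hq⟩ := hW
  have ha := (key q hq).1
  obtain ⟨ε, hε, hB⟩ := Metric.mem_nhds_iff.1 (W.isOpen.mem_nhds hq)
  have hq' : (q.1, q.2 + ε / 2) ∈ W := hB (by
    rw [Metric.mem_ball, Prod.dist_eq]
    simp [abs_of_pos hε, hε])
  have hb : b = 0 := by
    have h1 := (key q hq).2
    have h2 := (key _ hq').2
    simp only at h2
    have : b * (ε / 2) = 0 := by linarith
    simpa [hε.ne'] using this
  simp [ha, hb]

end VF

namespace PlaneCoord

variable {U : Opens Plane} (φ : PlaneCoord U)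

theorem isConnected_range : IsConnected (φ.range : Set Plane) := by
  change IsConnected φ.map.target
  rw [← φ.map.image_source_eq_target]
  exact φ.source_connected.image _ φ.map.continuousOn

theorem mem_range_translateY {b : ℝ} {q : Plane} (hq : q ∈ (φ.translateY b).range) :
    q - (0, b) ∈ φ.range := by
  rw [sub_eq_add_neg]; exact hq

theorem push_translateY (b : ℝ) (X : VF U) {q : Plane} (hq : q ∈ (φ.translateY b).range) :
    (φ.translateY b).push X q = φ.push X (q - (0, b)) := by
  rw [push_apply _ X hq, push_apply _ X (φ.mem_range_translateY hq)]
  have h1 : ((φ.translateY b).map.symm q) = φ.map.symm (q - (0, b)) := by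
    rw [sub_eq_add_neg]; rfl
  have h2 : ((φ.translateY b).map : Plane → Plane) = fun p => φ.map p + (0, b) := rfl
  rw [h1, h2, fderiv_add_const]

theorem isCanonical_translateY {e w : VF U} (h : φ.IsCanonical e w) (b : ℝ) :
    (φ.translateY b).IsCanonical e w := by
  constructor <;> refine VF.ext_on fun q hq => ?_
  · rw [push_translateY _ _ _ hq, h.1, VF.ddx_apply hq, VF.ddx_apply (φ.mem_range_translateY hq)]
  · rw [push_translateY _ _ _ hq, h.2, VF.ddy_apply hq, VF.ddy_apply (φ.mem_range_translateY hq)]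

end PlaneCoord

theorem Submodule.span_pair_smul {R M : Type*} [Field R] [AddCommGroup M] [Module R M] {c : R}
    (hc : c ≠ 0) (x y : M) : span R {x, c • y} = span R {x, y} := by
  rw [span_insert, span_insert, span_singleton_smul_eq (isUnit_iff_ne_zero.2 hc)]

theorem Submodule.span_triple_smul {R M : Type*} [Field R] [AddCommGroup M] [Module R M] {c d : R}
    (hc : c ≠ 0) (hd : d ≠ 0) (x y z : M) : span R {x, c • y, d • z} = span R {x, y, z} := by
  rw [span_insert, span_insert, span_insert, span_insert,
    span_singleton_smul_eq (isUnit_iff_ne_zero.2 hc),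
    span_singleton_smul_eq (isUnit_iff_ne_zero.2 hd)]

/-! ### The prolonged action -/

section Prolongation

variable {W : Opens Plane}

theorem isOpen_jetDomain (W : Opens Plane) : IsOpen (jetDomain W) :=
  W.isOpen.preimage (by fun_prop)

/-- The total derivative of `b y^{(i)} + H(x)` is `b y^{(i+1)} + H'(x)` for `i ≤ 2`. The index
`j = i + 1` is that of the jet coordinate `y^{(i)}`; for `j = 0` the function is `b x + H(x)`. -/
theorem totalD_eq {f : Jet → ℝ} {z : Jet} (j : Fin 5) {b : ℝ} {H : ℝ → ℝ} {H' : ℝ}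
    (hH : HasDerivAt H H' (z 0)) (hf : ∀ᶠ y in 𝓝 z, f y = b * y j + H (y 0)) :
    totalD f z = b * (![1, z 2, z 3, z 4, 0] : Jet) j + H' := by
  have h0 : HasFDerivAt (fun y : Jet => y 0)
      (ContinuousLinearMap.proj 0 : Jet →L[ℝ] ℝ) z :=
    (ContinuousLinearMap.proj 0 : Jet →L[ℝ] ℝ).hasFDerivAt
  have hj : HasFDerivAt (fun y : Jet => y j)
      (ContinuousLinearMap.proj j : Jet →L[ℝ] ℝ) z :=
    (ContinuousLinearMap.proj j : Jet →L[ℝ] ℝ).hasFDerivAt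
  have h1 : HasFDerivAt (fun y : Jet => b * y j + H (y 0))
      (b • (ContinuousLinearMap.proj j : Jet →L[ℝ] ℝ) +
        H' • (ContinuousLinearMap.proj 0 : Jet →L[ℝ] ℝ)) z :=
    (hj.const_mul b).add (hH.comp_hasFDerivAt z h0)
  rw [totalD, (h1.congr_of_eventuallyEq hf).fderiv]
  simp

theorem totalD_eq_zero {f : Jet → ℝ} {z : Jet} {a : ℝ} (hf : ∀ᶠ y in 𝓝 z, f y = a) :
    totalD f z = 0 := by
  simpa using totalD_eq (H := fun _ => a) (b := 0) 0 (hasDerivAt_const _ _)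
    (hf.mono fun y hy => by rw [hy]; ring)

/-- The prolongation of a field `a ∂_x + (b y + h(x)) ∂_y`. -/
theorem prolong_eq {X : Plane → Plane} {a b : ℝ} {h h₁ h₂ h₃ : ℝ → ℝ}
    (hX : ∀ q ∈ W, X q = (a, b * q.2 + h q.1)) (d₁ : ∀ x, HasDerivAt h (h₁ x) x)
    (d₂ : ∀ x, HasDerivAt h₁ (h₂ x) x) (d₃ : ∀ x, HasDerivAt h₂ (h₃ x) x) {z : Jet}
    (hz : z ∈ jetDomain W) :
    prolong X z = ![a, b * z 1 + h (z 0), b * z 2 + h₁ (z 0), b * z 3 + h₂ (z 0),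
      b * z 4 + h₃ (z 0)] := by
  have ev : ∀ {P : Jet → Prop}, (∀ y ∈ jetDomain W, P y) → ∀ y ∈ jetDomain W, ∀ᶠ x in 𝓝 y, P x :=
    fun hP y hy => Filter.eventually_of_mem ((isOpen_jetDomain W).mem_nhds hy) hP
  have hxi : ∀ y ∈ jetDomain W, xiCoeff X y = a := fun y hy => by rw [xiCoeff, hX _ hy]
  have heta : ∀ y ∈ jetDomain W, etaCoeff X y = b * y 1 + h (y 0) := fun y hy => by
    rw [etaCoeff, hX _ hy]
  have hxi' : ∀ y ∈ jetDomain W, totalD (xiCoeff X) y = 0 := fun y hy =>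
    totalD_eq_zero (ev hxi y hy)
  have h1 : ∀ y ∈ jetDomain W, eta1 X y = b * y 2 + h₁ (y 0) := fun y hy => by
    rw [eta1, hxi' y hy, totalD_eq 1 (d₁ _) (ev heta y hy)]; simp
  have h2 : ∀ y ∈ jetDomain W, eta2 X y = b * y 3 + h₂ (y 0) := fun y hy => by
    rw [eta2, hxi' y hy, totalD_eq 2 (d₂ _) (ev h1 y hy)]; simp
  have h3 : ∀ y ∈ jetDomain W, eta3 X y = b * y 4 + h₃ (y 0) := fun y hy => by
    rw [eta3, hxi' y hy, totalD_eq 3 (d₃ _) (ev h2 y hy)]; simp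
  rw [prolong, hxi z hz, heta z hz, h1 z hz, h2 z hz, h3 z hz]

/-- The canonical five-dimensional algebra `⟨∂_x, y ∂_y⟩ ⊕ ⟨∂_y, e^{lx} ∂_y, e^{mx} ∂_y⟩`. -/
noncomputable def canonicalAlgebra (W : Opens Plane) (l m : ℝ) : Submodule ℝ (VF W) :=
  Submodule.span ℝ {VF.ddx W, VF.yddy W} ⊔
    Submodule.span ℝ {VF.ddy W, VF.expddy W l, VF.expddy W m}

/-- The third prolongation of `a ∂_x + (b y + c + d e^{lx} + f e^{mx}) ∂_y`. -/
noncomputable def jetField (l m a b c d f : ℝ) (z : Jet) : Jet :=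
  ![a, b * z 1 + (c + d * Real.exp (l * z 0) + f * Real.exp (m * z 0)),
    b * z 2 + (l * d * Real.exp (l * z 0) + m * f * Real.exp (m * z 0)),
    b * z 3 + (l ^ 2 * d * Real.exp (l * z 0) + m ^ 2 * f * Real.exp (m * z 0)),
    b * z 4 + (l ^ 3 * d * Real.exp (l * z 0) + m ^ 3 * f * Real.exp (m * z 0))]

theorem mem_canonicalAlgebra {l m : ℝ} {X : VF W} :
    X ∈ canonicalAlgebra W l m ↔ ∃ a b c d f : ℝ, X = (a • VF.ddx W + b • VF.yddy W) +
      (c • VF.ddy W + d • VF.expddy W l + f • VF.expddy W m) := by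
  rw [canonicalAlgebra, Submodule.mem_sup]
  constructor
  · rintro ⟨y, hy, z, hz, rfl⟩
    obtain ⟨a, b, rfl⟩ := Submodule.mem_span_pair.1 hy
    obtain ⟨c, d, f, rfl⟩ := Submodule.mem_span_triple.1 hz
    exact ⟨a, b, c, d, f, rfl⟩
  · rintro ⟨a, b, c, d, f, rfl⟩
    exact ⟨_, Submodule.mem_span_pair.2 ⟨a, b, rfl⟩, _,
      Submodule.mem_span_triple.2 ⟨c, d, f, rfl⟩, rfl⟩

theorem prolong_canonical {l m : ℝ} (a b c d f : ℝ) {z : Jet} (hz : z ∈ jetDomain W) :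
    prolong ((a • VF.ddx W + b • VF.yddy W) +
      (c • VF.ddy W + d • VF.expddy W l + f • VF.expddy W m) : VF W) z =
      jetField l m a b c d f z := by
  have he : ∀ n x : ℝ, HasDerivAt (fun x => Real.exp (n * x)) (n * Real.exp (n * x)) x :=
    fun n x => by
      simpa [mul_comm] using ((hasDerivAt_id x).const_mul n).exp
  refine prolong_eq (h := fun x => c + d * Real.exp (l * x) + f * Real.exp (m * x))
    (h₁ := fun x => l * d * Real.exp (l * x) + m * f * Real.exp (m * x))
    (h₂ := fun x => l ^ 2 * d * Real.exp (l * x) + m ^ 2 * f * Real.exp (m * x))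
    (h₃ := fun x => l ^ 3 * d * Real.exp (l * x) + m ^ 3 * f * Real.exp (m * x))
    (fun q hq => ?_) (fun x => ?_) (fun x => ?_) (fun x => ?_) hz
  · simp only [VF.add_apply, VF.smul_apply, VF.ddx_apply hq, VF.ddy_apply hq, VF.yddy_apply hq,
      VF.expddy_apply _ hq]
    ext <;> simp
  · exact ((((he l x).const_mul d).const_add c).add ((he m x).const_mul f)).congr_deriv (by ring)
  · exact (((he l x).const_mul _).add ((he m x).const_mul _)).congr_deriv (by ring)
  · exact (((he l x).const_mul _).add ((he m x).const_mul _)).congr_deriv (by ring)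

theorem exists_jetField {l m : ℝ} {Z : Jet → Jet}
    (hZ : Z ∈ prolongation (canonicalAlgebra W l m)) :
    ∃ a b c d f : ℝ, ∀ z ∈ jetDomain W, Z z = jetField l m a b c d f z := by
  obtain ⟨_, ⟨X, hX, rfl⟩, rfl⟩ := hZ
  obtain ⟨a, b, c, d, f, rfl⟩ := mem_canonicalAlgebra.1 hX
  exact ⟨a, b, c, d, f, fun z hz => prolong_canonical a b c d f hz⟩

theorem exists_mem_prolongation (W : Opens Plane) (l m a b c d f : ℝ) :
    ∃ Z ∈ prolongation (canonicalAlgebra W l m), ∀ z ∈ jetDomain W,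
      Z z = jetField l m a b c d f z :=
  ⟨_, ⟨_, ⟨_, mem_canonicalAlgebra.2 ⟨a, b, c, d, f, rfl⟩, rfl⟩, rfl⟩,
    fun _ hz => prolong_canonical a b c d f hz⟩

/-- The linear function `y''' - (l + m) y'' + l m y'`, whose zeros over `W` form `odeLocus`. -/
noncomputable def odeForm (l m : ℝ) : Jet →L[ℝ] ℝ :=
  ContinuousLinearMap.proj 4 - (l + m) • ContinuousLinearMap.proj 3 +
    (l * m) • ContinuousLinearMap.proj 2

theorem odeForm_apply (l m : ℝ) (z : Jet) :
    odeForm l m z = z 4 - (l + m) * z 3 + l * m * z 2 := rfl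

theorem mem_odeLocus {l m : ℝ} {z : Jet} :
    z ∈ odeLocus W l m ↔ z ∈ jetDomain W ∧ odeForm l m z = 0 := Iff.rfl

/-- The prolonged fields scale `y''' - (l + m) y'' + l m y'`. -/
theorem odeForm_jetField (l m a b c d f : ℝ) (z : Jet) :
    odeForm l m (jetField l m a b c d f z) = b * odeForm l m z := by
  simp [odeForm_apply, jetField]; ring

/-- Every vertical vector on which `odeForm` vanishes is, at points over `x`, the value of the
prolongation of some `(c + d e^{lx} + f e^{mx}) ∂_y`. The further term is the prolongation of
`b y ∂_y`. -/
theorem exists_jetField_vertical {l m : ℝ} (hl : l ≠ 0) (hm : m ≠ 0) (hlm : l ≠ m) (x : ℝ)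
    {v : Jet} (h0 : v 0 = 0) (hv : odeForm l m v = 0) :
    ∃ c d f : ℝ, ∀ b : ℝ, ∀ z : Jet, z 0 = x →
      jetField l m 0 b c d f z = v + b • ![0, z 1, z 2, z 3, z 4] := by
  have hml : m - l ≠ 0 := sub_ne_zero.2 hlm.symm
  have el := (Real.exp_pos (l * x)).ne'
  have em := (Real.exp_pos (m * x)).ne'
  have h4 : v 4 = (l + m) * v 3 - l * m * v 2 := by
    rw [odeForm_apply] at hv; linarith
  set D := (m * v 2 - v 3) / (l * (m - l))
  set F := (v 3 - l * v 2) / (m * (m - l))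
  have h2 : l * D + m * F = v 2 := by simp only [D, F]; field_simp; ring
  have h3 : l ^ 2 * D + m ^ 2 * F = v 3 := by simp only [D, F]; field_simp; ring
  have h4' : l ^ 3 * D + m ^ 3 * F = v 4 := by rw [h4, ← h2, ← h3]; ring
  -- `D` and `F` are the values of the two exponential terms, as determined by `v 2` and `v 3`
  refine ⟨v 1 - D - F, D / Real.exp (l * x), F / Real.exp (m * x), fun b z hz => ?_⟩
  have e1 : ∀ t : ℝ, t * (D / Real.exp (l * x)) * Real.exp (l * x) = t * D := fun t => by
    field_simp
  have e2 : ∀ t : ℝ, t * (F / Real.exp (m * x)) * Real.exp (m * x) = t * F := fun t => by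
    field_simp
  rw [jetField, hz, e1, e1, e1, e2, e2, e2, h2, h3, h4', div_mul_cancel₀ _ el,
    div_mul_cancel₀ _ em]
  ext i
  fin_cases i
  · simp [h0]
  · simp; ring
  · simp; ring
  · simp; ring
  · simp; ring

theorem flowStep_line {Ω : Set Jet} {L : Set (Jet → Jet)} {Z : Jet → Jet} (hZ : Z ∈ L) {z v : Jet}
    (h : ∀ t ∈ Icc (0 : ℝ) 1, z + t • v ∈ Ω ∧ Z (z + t • v) = v) : FlowStep Ω L z (z + v) := by
  refine ⟨Z, hZ, fun t => z + t • v, by simp, by simp, fun t ht => (h t ht).1, fun t ht => ?_⟩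
  have h1 : HasDerivAt (fun t : ℝ => z + t • v) v t := by
    simpa using ((hasDerivAt_id t).smul_const v).const_add z
  change HasDerivWithinAt _ (Z (z + t • v)) _ _
  rw [(h t ht).2]
  exact h1.hasDerivWithinAt

/-- Over a square of `W`, a point `z'` is reached from `z` if `odeForm z'` is a positive multiple
`e^b` of `odeForm z` and scaling by `e^b` keeps the base point in the square: move `x`, then scale
by `e^b`, then move in the vertical direction. -/
theorem mem_orbit {l m : ℝ} (hl : l ≠ 0) (hm : m ≠ 0) (hlm : l ≠ m) {p : Plane} {ε b : ℝ}
    (hB : Metric.ball p ε ⊆ W) {z z' : Jet} (hz : (z 0, z 1) ∈ Metric.ball p ε)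
    (hz' : (z' 0, z' 1) ∈ Metric.ball p ε) (hb : (z 0, Real.exp b * z 1) ∈ Metric.ball p ε)
    (h : odeForm l m z' = Real.exp b * odeForm l m z) :
    z' ∈ orbit (jetDomain W) (prolongation (canonicalAlgebra W l m)) z := by
  have hBp : ∀ x y : ℝ, (x, y) ∈ Metric.ball p ε ↔
      x ∈ Metric.ball p.1 ε ∧ y ∈ Metric.ball p.2 ε := fun x y => by
    rw [← Prod.mk.eta (p := p), ← ball_prod_same]; rfl
  rw [hBp] at hz hz' hb
  have hdom : ∀ y : Jet, y 0 ∈ Metric.ball p.1 ε → y 1 ∈ Metric.ball p.2 ε → y ∈ jetDomain W :=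
    fun y h0 h1 => hB ((hBp _ _).2 ⟨h0, h1⟩)
  have hseg : ∀ {c r u v t : ℝ}, u ∈ Metric.ball c r → v ∈ Metric.ball c r → t ∈ Icc (0 : ℝ) 1 →
      u + t * (v - u) ∈ Metric.ball c r := fun hu hv ht =>
    (convex_ball _ _).add_smul_sub_mem hu hv ht
  set z₁ : Jet := ![z' 0, z 1, z 2, z 3, z 4]
  set z₂ : Jet := ![z' 0, Real.exp b * z 1, Real.exp b * z 2, Real.exp b * z 3, Real.exp b * z 4]
  have s1 : FlowStep (jetDomain W) (prolongation (canonicalAlgebra W l m)) z z₁ := by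
    obtain ⟨Z, hZ, hZe⟩ := exists_mem_prolongation W l m (z' 0 - z 0) 0 0 0 0
    have e : z₁ = z + ![z' 0 - z 0, 0, 0, 0, 0] := by
      ext i; fin_cases i <;> simp [z₁]
    rw [e]
    refine flowStep_line hZ fun t ht => ?_
    have hd : z + t • ![z' 0 - z 0, 0, 0, 0, 0] ∈ jetDomain W := by
      refine hdom _ ?_ ?_
      · simpa using hseg hz.1 hz'.1 ht
      · simpa using hz.2
    refine ⟨hd, ?_⟩
    rw [hZe _ hd, jetField]
    ext i; fin_cases i <;> simp
  have s2 : FlowStep (jetDomain W) (prolongation (canonicalAlgebra W l m)) z₁ z₂ := by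
    obtain ⟨Z, hZ, hZe⟩ := exists_mem_prolongation W l m 0 b 0 0 0
    set γ : ℝ → Jet := fun t => ![z' 0, Real.exp (t * b) * z 1, Real.exp (t * b) * z 2,
      Real.exp (t * b) * z 3, Real.exp (t * b) * z 4]
    have hd : ∀ t ∈ Icc (0 : ℝ) 1, γ t ∈ jetDomain W := fun t ht => by
      refine hdom _ hz'.1 ?_
      have hconv : Convex ℝ {s : ℝ | s * z 1 ∈ Metric.ball p.2 ε} :=
        (convex_ball p.2 ε).is_linear_preimage (f := fun s : ℝ => s * z 1)
          (IsLinearMap.mk (fun _ _ => add_mul _ _ _) (fun _ _ => mul_assoc _ _ _))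
      have hmem : Real.exp (t * b) ∈ uIcc 1 (Real.exp b) := by
        rw [mem_uIcc]
        rcases le_total 0 b with hb0 | hb0
        · exact Or.inl ⟨Real.one_le_exp (mul_nonneg ht.1 hb0),
            Real.exp_le_exp.2 (by nlinarith [ht.2])⟩
        · exact Or.inr ⟨Real.exp_le_exp.2 (by nlinarith [ht.2]),
            Real.exp_le_one_iff.2 (mul_nonpos_of_nonneg_of_nonpos ht.1 hb0)⟩
      exact hconv.ordConnected.uIcc_subset (by simpa using hz.2) hb.2 hmem
    refine ⟨Z, hZ, γ, by simp [γ, z₁], by simp [γ, z₂], hd, fun t ht => ?_⟩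
    refine HasDerivAt.hasDerivWithinAt ?_
    change HasDerivAt γ (Z (γ t)) t
    rw [hZe _ (hd t ht), hasDerivAt_pi]
    have he : ∀ s : ℝ, HasDerivAt (fun t => Real.exp (t * b) * s) (b * (Real.exp (t * b) * s)) t :=
      fun s => (((hasDerivAt_id t).mul_const b).exp.mul_const s).congr_deriv (by simp; ring)
    intro i
    fin_cases i
    · simpa [γ, jetField] using hasDerivAt_const t (z' 0)
    all_goals simpa [γ, jetField] using he _
  have s3 : FlowStep (jetDomain W) (prolongation (canonicalAlgebra W l m)) z₂ z' := by
    have hv : odeForm l m (z' - z₂) = 0 := by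
      rw [map_sub, h, sub_eq_zero]
      simp [odeForm_apply, z₂]; ring
    obtain ⟨c, d, f, hv⟩ := exists_jetField_vertical hl hm hlm (z' 0) (v := z' - z₂)
      (by simp [z₂]) hv
    obtain ⟨Z, hZ, hZe⟩ := exists_mem_prolongation W l m 0 0 c d f
    have e : z' = z₂ + (z' - z₂) := by abel
    rw [e]
    refine flowStep_line hZ fun t ht => ?_
    have h0 : (z₂ + t • (z' - z₂)) 0 = z' 0 := by
      change z' 0 + t * (z' 0 - z' 0) = z' 0
      ring
    have hd : z₂ + t • (z' - z₂) ∈ jetDomain W := by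
      refine hdom _ (h0 ▸ hz'.1) ?_
      exact hseg hb.2 hz'.2 ht
    refine ⟨hd, ?_⟩
    rw [hZe _ hd, hv 0 _ h0, zero_smul, add_zero]
  exact ((Relation.ReflTransGen.single s1).tail s2).tail s3

end Prolongation

/-! ### Orbits, hypersurfaces and equations in the extended space -/

section JetOrbits

variable {W : Opens Plane} {l m : ℝ}

theorem exists_ball_subset {z : Jet} (hz : z ∈ jetDomain W) :
    ∃ ε > 0, Metric.ball (z 0, z 1) ε ⊆ (W : Set Plane) :=
  Metric.mem_nhds_iff.1 (W.isOpen.mem_nhds hz)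

/-- Near a point off the locus, `odeForm` keeps its sign, and the orbit fills a neighbourhood. -/
theorem orbit_mem_nhds (hl : l ≠ 0) (hm : m ≠ 0) (hlm : l ≠ m) {z : Jet} (hz : z ∈ jetDomain W)
    (h : odeForm l m z ≠ 0) :
    orbit (jetDomain W) (prolongation (canonicalAlgebra W l m)) z ∈ 𝓝 z := by
  obtain ⟨ε, hε, hB⟩ := exists_ball_subset hz
  have h1 : ∀ᶠ y : Jet in 𝓝 z, (y 0, y 1) ∈ Metric.ball (z 0, z 1) ε :=
    (Continuous.continuousAt (by fun_prop)).eventually_mem (Metric.ball_mem_nhds _ hε)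
  have hr : ContinuousAt (fun y : Jet => odeForm l m y / odeForm l m z) z :=
    ((odeForm l m).continuous.div_const _).continuousAt
  have h2 : ∀ᶠ y : Jet in 𝓝 z, 0 < odeForm l m y / odeForm l m z :=
    hr.eventually_mem (Ioi_mem_nhds (by simp [h]))
  have h3 : ∀ᶠ y : Jet in 𝓝 z,
      (z 0, odeForm l m y / odeForm l m z * z 1) ∈ Metric.ball (z 0, z 1) ε := by
    refine (continuousAt_const.prodMk (hr.mul continuousAt_const)).eventually_mem ?_
    change Metric.ball (z 0, z 1) ε ∈ 𝓝 (z 0, odeForm l m z / odeForm l m z * z 1)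
    rw [div_self h, one_mul]
    exact Metric.ball_mem_nhds _ hε
  filter_upwards [h1, h2, h3] with y hy1 hy2 hy3
  refine mem_orbit hl hm hlm (b := Real.log (odeForm l m y / odeForm l m z)) hB
    (Metric.mem_ball_self hε) hy1 ?_ ?_
  · rwa [Real.exp_log hy2]
  · rw [Real.exp_log hy2, div_mul_cancel₀ _ h]

theorem orbitDim_eq_five (hl : l ≠ 0) (hm : m ≠ 0) (hlm : l ≠ m) {z : Jet}
    (hz : z ∈ jetDomain W) (h : z ∉ odeLocus W l m) :
    orbitDim (jetDomain W) (prolongation (canonicalAlgebra W l m)) z = 5 := by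
  rw [orbitDim, Real.dimH_of_mem_nhds
    (orbit_mem_nhds hl hm hlm hz fun h0 => h (mem_odeLocus.2 ⟨hz, h0⟩))]
  simp

/-- Along an integral curve of a prolonged field `odeForm` solves `u' = b u`, so it stays zero. -/
theorem isOrbitInvariant_odeLocus :
    IsOrbitInvariant (jetDomain W) (prolongation (canonicalAlgebra W l m)) (odeLocus W l m) := by
  refine fun z hz => orbit_subset hz ?_
  rintro _ hz _ ⟨Z, hZ, γ, rfl, rfl, hγ, hd⟩
  obtain ⟨a, b, c, d, f, hZe⟩ := exists_jetField hZ
  have h1 : ∀ t ∈ Icc (0 : ℝ) 1, HasDerivWithinAt (fun t => odeForm l m (γ t))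
      (b * odeForm l m (γ t)) (Icc 0 1) t := fun t ht => by
    have h2 : HasDerivWithinAt (fun t => odeForm l m (γ t)) (odeForm l m (Z (γ t))) (Icc 0 1) t :=
      (odeForm l m).hasFDerivAt.comp_hasDerivWithinAt t (hd t ht)
    rwa [hZe _ (hγ t ht), odeForm_jetField] at h2
  refine mem_odeLocus.2 ⟨hγ 1 ⟨zero_le_one, le_rfl⟩, ?_⟩
  refine eq_zero_of_abs_deriv_le_mul_abs_self_of_eq_zero_right (K := |b|)
    (fun t ht => (h1 t ht).continuousWithinAt)
    (fun t ht => (h1 t ⟨ht.1, ht.2.le⟩).mono_of_mem_nhdsWithin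
      (mem_nhdsWithin.2 ⟨Iio 1, isOpen_Iio, ht.2, fun s hs => ⟨ht.1.trans hs.2, le_of_lt hs.1⟩⟩))
    (mem_odeLocus.1 hz).2 (fun t _ => (norm_mul _ _).le) 1 ⟨zero_le_one, le_rfl⟩

theorem orbitDim_lt_five {z : Jet} (hz : z ∈ odeLocus W l m) :
    orbitDim (jetDomain W) (prolongation (canonicalAlgebra W l m)) z < 5 := by
  have hsub : orbit (jetDomain W) (prolongation (canonicalAlgebra W l m)) z ⊆
      range fun u : Fin 4 → ℝ =>
        (![u 0, u 1, u 2, u 3, (l + m) * u 3 - l * m * u 2] : Jet) := by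
    intro y hy
    have h := (isOrbitInvariant_odeLocus z hz hy).2
    refine ⟨jetTrunc y, ?_⟩
    ext i
    fin_cases i
    · rfl
    · rfl
    · rfl
    · rfl
    · change (l + m) * y 3 - l * m * y 2 = y 4
      linarith
  have hc : ContDiff ℝ 1 fun u : Fin 4 → ℝ =>
      (![u 0, u 1, u 2, u 3, (l + m) * u 3 - l * m * u 2] : Jet) := by
    rw [contDiff_pi]
    intro i
    fin_cases i <;> simp <;> fun_prop
  refine ((dimH_mono hsub).trans hc.dimH_range_le).trans_lt ?_
  simp
  norm_num

theorem isHypersurface_odeLocus (hW : (W : Set Plane).Nonempty) :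
    IsHypersurface (jetDomain W) (odeLocus W l m) := by
  refine ⟨?_, fun z hz => hz.1, fun z hz => ⟨jetDomain W, odeForm l m, isOpen_jetDomain W, hz.1,
    subset_rfl, (odeForm l m).contDiff.contDiffOn, fun q _ h => ?_, ?_⟩⟩
  · obtain ⟨p, hp⟩ := hW
    exact ⟨![p.1, p.2, 0, 0, 0], hp, by simp⟩
  · rw [ContinuousLinearMap.fderiv] at h
    have := DFunLike.congr_fun h ![0, 0, 0, 0, 1]
    simp [odeForm_apply] at this
  · ext q
    exact ⟨fun h => ⟨h.1.1, h.1.2⟩, fun h => ⟨⟨h.1, h.2⟩, h.1⟩⟩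

/-- A hypersurface has empty interior, because its local equations have nonzero derivative. -/
theorem IsHypersurface.notMem_nhds {E : Type*} [NormedAddCommGroup E] [NormedSpace ℝ E]
    {Ω S : Set E} (h : IsHypersurface Ω S) {z : E} (hz : z ∈ S) : S ∉ 𝓝 z := by
  intro hS
  obtain ⟨N, F, hN, hzN, -, -, hF, hSN⟩ := h.2.2 z hz
  refine hF z hzN ?_
  have h0 : F =ᶠ[𝓝 z] fun _ => 0 := by
    filter_upwards [hS, hN.mem_nhds hzN] with q hq hqN
    have : q ∈ S ∩ N := ⟨hq, hqN⟩
    rw [hSN] at this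
    exact this.2
  rw [h0.fderiv_eq, fderiv_const_apply]

/-- An invariant hypersurface avoids the open orbits, so it lies in the locus of the equation; as
the orbits there project onto open subsets of the connected set `W`, it is the whole locus. -/
theorem eq_odeLocus_of_isOrbitInvariant (hl : l ≠ 0) (hm : m ≠ 0) (hlm : l ≠ m)
    (hW : IsPreconnected (W : Set Plane)) {S : Set Jet} (hS : IsHypersurface (jetDomain W) S)
    (hinv : IsOrbitInvariant (jetDomain W) (prolongation (canonicalAlgebra W l m)) S) :
    S = odeLocus W l m := by
  have hsub : S ⊆ odeLocus W l m := by
    intro z hz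
    by_contra h
    exact hS.notMem_nhds hz (Filter.mem_of_superset (orbit_mem_nhds hl hm hlm (hS.2.1 hz)
      fun h0 => h (mem_odeLocus.2 ⟨hS.2.1 hz, h0⟩)) (hinv z hz))
  set P : Set Plane := (fun z : Jet => (z 0, z 1)) '' S
  have hstep : ∀ {p : Plane} {ε : ℝ}, Metric.ball p ε ⊆ W → ∀ z ∈ S,
      (z 0, z 1) ∈ Metric.ball p ε → ∀ z' ∈ odeLocus W l m, (z' 0, z' 1) ∈ Metric.ball p ε →
      z' ∈ S := by
    intro p ε hB z hz hzB z' hz' hzB'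
    refine hinv z hz (mem_orbit hl hm hlm (b := 0) hB hzB hzB' (by simpa using hzB) ?_)
    rw [(mem_odeLocus.1 hz').2, (mem_odeLocus.1 (hsub hz)).2, mul_zero]
  have hball : ∀ {p : Plane} {ε : ℝ}, Metric.ball p ε ⊆ W → (Metric.ball p ε ∩ P).Nonempty →
      Metric.ball p ε ⊆ P := by
    rintro p ε hB ⟨_, hq, z, hz, rfl⟩ q' hq'
    exact ⟨![q'.1, q'.2, 0, 0, 0], hstep hB z hz hq _
      (mem_odeLocus.2 ⟨hB hq', by simp [odeForm_apply]⟩) hq', rfl⟩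
  have hPo : IsOpen P := by
    rw [Metric.isOpen_iff]
    rintro _ ⟨z, hz, rfl⟩
    obtain ⟨ε, hε, hB⟩ := exists_ball_subset (hS.2.1 hz)
    exact ⟨ε, hε, hball hB ⟨_, Metric.mem_ball_self hε, z, hz, rfl⟩⟩
  have hPW : (W : Set Plane) ⊆ P := by
    refine hW.subset_of_closure_inter_subset hPo ?_ ?_
    · obtain ⟨z, hz⟩ := hS.1
      exact ⟨_, hS.2.1 hz, z, hz, rfl⟩
    · rintro q ⟨hq, hqW⟩
      obtain ⟨ε, hε, hB⟩ := Metric.mem_nhds_iff.1 (W.isOpen.mem_nhds hqW)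
      refine hball hB ?_ (Metric.mem_ball_self hε)
      exact mem_closure_iff.1 hq _ Metric.isOpen_ball (Metric.mem_ball_self hε)
  refine hsub.antisymm fun z hz => ?_
  obtain ⟨ε, hε, hB⟩ := exists_ball_subset hz.1
  obtain ⟨y, hy, hyz⟩ := hPW hz.1
  refine hstep hB y hy ?_ z hz (Metric.mem_ball_self hε)
  change (y 0, y 1) = (z 0, z 1) at hyz
  rw [hyz]
  exact Metric.mem_ball_self hε

/-- Off the locus of the equation the prolonged fields span all directions, in particular the
direction of `y'''`, which is not tangent to a graph. -/
theorem isInvariantODE_iff (hl : l ≠ 0) (hm : m ≠ 0) (hlm : l ≠ m) {D : Set (Fin 4 → ℝ)}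
    {F : (Fin 4 → ℝ) → ℝ} (hD : IsOpen D) (hDW : ∀ u ∈ D, (u 0, u 1) ∈ W) :
    IsInvariantODE (canonicalAlgebra W l m) D F ↔
      ∀ u ∈ D, F u = (l + m) * u 3 - l * m * u 2 := by
  constructor
  · intro h u hu
    set z : Jet := ![u 0, u 1, u 2, u 3, F u]
    have hzt : jetTrunc z = u := by
      ext i; fin_cases i <;> rfl
    have hzd : z ∈ jetDomain W := hDW u hu
    by_contra hne
    have hz : odeForm l m z ≠ 0 := fun h0 => hne (by
      change F u - (l + m) * u 3 + l * m * u 2 = 0 at h0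
      linarith)
    set b := (odeForm l m z)⁻¹
    have hv : odeForm l m (![0, 0, 0, 0, 1] - b • ![0, z 1, z 2, z 3, z 4]) = 0 := by
      have h1 : odeForm l m ![0, z 1, z 2, z 3, z 4] = odeForm l m z := rfl
      rw [map_sub, map_smul, h1, smul_eq_mul, inv_mul_cancel₀ hz]
      simp [odeForm_apply]
    -- at `z`, `b` times the scaling field plus a vertical field is the direction of `y'''`
    obtain ⟨c, d, f, hcdf⟩ := exists_jetField_vertical hl hm hlm (z 0) (by simp) hv
    obtain ⟨Z, hZ, hZe⟩ := exists_mem_prolongation W l m 0 b c d f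
    have hZz : Z z = ![0, 0, 0, 0, 1] := by rw [hZe z hzd, hcdf b z rfl, sub_add_cancel]
    have h1 := h Z hZ z (hzt ▸ hu) (by rw [hzt]; rfl)
    have h2 : jetTrunc ![0, 0, 0, 0, 1] = 0 := by
      ext i; fin_cases i <;> rfl
    rw [hZz, h2, map_zero] at h1
    simp at h1
  · intro h Z hZ z hz hzF
    obtain ⟨a, b, c, d, f, hZe⟩ := exists_jetField hZ
    have hzd : z ∈ jetDomain W := hDW _ hz
    set G : (Fin 4 → ℝ) →L[ℝ] ℝ :=
      (l + m) • ContinuousLinearMap.proj 3 - (l * m) • ContinuousLinearMap.proj 2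
    have hFG : F =ᶠ[𝓝 (jetTrunc z)] G := by
      filter_upwards [hD.mem_nhds hz] with u hu using h u hu
    have hG : ∀ y : Jet, odeForm l m y = y 4 - G (jetTrunc y) := fun y => by
      change y 4 - (l + m) * y 3 + l * m * y 2 = y 4 - ((l + m) * y 3 - l * m * y 2)
      ring
    rw [hFG.fderiv_eq, ContinuousLinearMap.fderiv, ← sub_eq_zero, ← hG, hZe z hzd,
      odeForm_jetField, hG, hzF, hFG.eq_of_nhds, sub_self, mul_zero]

end JetOrbits

/-! ### The canonical form and its invariant equation -/

theorem theorem4p2 (U : Opens Plane) (g : LieSubalgebra ℝ (VF U))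
    (hdim : VF.HasLocalDim g.toSubmodule 5)
    (hab : IsLieAbelian (LieAlgebra.derivedSeries ℝ g 1))
    (hrank : VF.rank (VF.commutatorOf g) = 1)
    (A : LieSubalgebra ℝ (VF U)) (hA : IsLieAbelian A)
    (hsup : A.toSubmodule ⊔ VF.commutatorOf g = g.toSubmodule)
    (hdisj : Disjoint A.toSubmodule (VF.commutatorOf g))
    (k lam mu : ℝ) (hk : k ≠ 0) (hlam : lam ≠ 0) (hmu : mu ≠ 0) (hlm : lam ≠ mu)
    (e₁ e₂ w e₄ e₅ : VF U)
    (hbasis : LinearIndependent ℝ ![e₁, e₂])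
    (hspan : A.toSubmodule = Submodule.span ℝ {e₁, e₂})
    (hw : w ∈ VF.commutatorOf g) (h₄ : e₄ ∈ VF.commutatorOf g) (h₅ : e₅ ∈ VF.commutatorOf g)
    (hw0 : w ≠ 0) (h₄0 : e₄ ≠ 0) (h₅0 : e₅ ≠ 0)
    (hw1 : ⁅e₁, w⁆ = (0 : ℝ) • w) (hw2 : ⁅e₂, w⁆ = k • w)
    (h₄1 : ⁅e₁, e₄⁆ = lam • e₄) (h₄2 : ⁅e₂, e₄⁆ = k • e₄)
    (h₅1 : ⁅e₁, e₅⁆ = mu • e₅) (h₅2 : ⁅e₂, e₅⁆ = k • e₅)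
    (hrank2 : VF.rank (VF.centralizerIn A w ⊔ Submodule.span ℝ {w}) = 2) :
    -- canonical coordinates exist at the points of the generic orbits of the algebra of rank 2
    (∃ p ∈ U, VF.orbDim (VF.centralizerIn A w ⊔ Submodule.span ℝ {w}) p = 2) ∧
    (∀ p ∈ U, VF.orbDim (VF.centralizerIn A w ⊔ Submodule.span ℝ {w}) p = 2 →
      ∃ φ : PlaneCoord U, p ∈ φ.map.source ∧ φ.IsCanonical e₁ w) ∧
    -- in any canonical coordinates, up to a translation of `y`
    ∀ φ : PlaneCoord U, φ.IsCanonical e₁ w → ∃ (b : ℝ) (ψ : PlaneCoord U),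
      ψ = φ.translateY b ∧ ψ.IsCanonical e₁ w ∧
      -- the canonical form of the algebra
      (A.toSubmodule.map ψ.push = Submodule.span ℝ {VF.ddx ψ.range, VF.yddy ψ.range} ∧
        (VF.commutatorOf g).map ψ.push =
          Submodule.span ℝ {VF.ddy ψ.range, VF.expddy ψ.range lam, VF.expddy ψ.range mu} ∧
        g.toSubmodule.map ψ.push = Submodule.span ℝ {VF.ddx ψ.range, VF.yddy ψ.range} ⊔
          Submodule.span ℝ {VF.ddy ψ.range, VF.expddy ψ.range lam, VF.expddy ψ.range mu} ∧
        Disjoint (Submodule.span ℝ {VF.ddx ψ.range, VF.yddy ψ.range})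
          (Submodule.span ℝ {VF.ddy ψ.range, VF.expddy ψ.range lam, VF.expddy ψ.range mu})) ∧
      -- the dimensions of the orbits in the extended space
      (∀ z ∈ jetDomain ψ.range,
        (z ∉ odeLocus ψ.range lam mu → orbitDim (jetDomain ψ.range)
          (prolongation (g.toSubmodule.map ψ.push)) z = 5) ∧
        (z ∈ odeLocus ψ.range lam mu → orbitDim (jetDomain ψ.range)
          (prolongation (g.toSubmodule.map ψ.push)) z < 5)) ∧
      -- the unique invariant hypersurface
      IsHypersurface (jetDomain ψ.range) (odeLocus ψ.range lam mu) ∧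
      (∀ S : Set Jet, IsHypersurface (jetDomain ψ.range) S →
        (IsOrbitInvariant (jetDomain ψ.range) (prolongation (g.toSubmodule.map ψ.push)) S ↔
          S = odeLocus ψ.range lam mu)) ∧
      -- the unique invariant equation of third order, also among those defined only locally
      (∀ (D : Set (Fin 4 → ℝ)) (F : (Fin 4 → ℝ) → ℝ), IsOpen D →
        (∀ u ∈ D, (u 0, u 1) ∈ ψ.range) → DifferentiableOn ℝ F D →
        (IsInvariantODE (g.toSubmodule.map ψ.push) D F ↔
          ∀ u ∈ D, F u = (lam + mu) * u 3 - lam * mu * u 2)) := by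
  obtain ⟨p₀, hp₀⟩ : (U : Set Plane).Nonempty := by
    by_contra h
    refine hw0 (VF.ext_on fun p hp => (h ⟨p, hp⟩).elim)
  have hg5 : Module.finrank ℝ g.toSubmodule = 5 := VF.finrank_eq_of_hasLocalDim ⟨p₀, hp₀⟩ hdim
  have hC : VF.commutatorOf g = Submodule.span ℝ {w, e₄, e₅} :=
    VF.commutatorOf_eq_span hg5 hsup hdisj hbasis hspan hw h₄ h₅ hw0 h₄0 h₅0 hlam hmu hlm
      hw1 h₄1 h₅1
  have he₁A : e₁ ∈ A.toSubmodule := hspan ▸ Submodule.subset_span (by simp)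
  have he₂A : e₂ ∈ A.toSubmodule := hspan ▸ Submodule.subset_span (by simp)
  have he₁w : ⁅e₁, w⁆ = 0 := by rw [hw1, zero_smul]
  set L := VF.centralizerIn A w ⊔ Submodule.span ℝ {w}
  have heL : e₁ ∈ L := Submodule.mem_sup_left ⟨he₁A, he₁w⟩
  have hwL : w ∈ L := Submodule.mem_sup_right (Submodule.mem_span_singleton_self w)
  have hL : ∀ X ∈ L, ∃ a b : ℝ, X = a • e₁ + b • w := by
    intro X hX
    obtain ⟨Y, ⟨hYA, hYw⟩, Z, hZ, rfl⟩ := Submodule.mem_sup.1 hX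
    obtain ⟨b, rfl⟩ := Submodule.mem_span_singleton.1 hZ
    have hYA' : Y ∈ A.toSubmodule := hYA
    rw [hspan] at hYA'
    obtain ⟨a, c, rfl⟩ := Submodule.mem_span_pair.1 hYA'
    rw [add_lie, smul_lie, smul_lie, he₁w, hw2, smul_zero, zero_add, smul_smul] at hYw
    have hc : c = 0 := by
      rcases smul_eq_zero.1 hYw with h | h
      · exact (mul_eq_zero.1 h).resolve_right hk
      · exact (hw0 h).elim
    exact ⟨a, b, by rw [hc, zero_smul, add_zero]⟩
  have hind : ∀ p ∈ U, ¬ VF.orbDim L p ≤ 1 → LinearIndependent ℝ ![e₁ p, w p] := fun p hp h => by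
    by_contra hdep
    exact h (VF.orbDim_le_one he₁w hL hp hdep)
  refine ⟨?_, fun p hp h2 => ?_, fun φ hφ => ?_⟩
  · -- if no orbit had dimension above `1`, the rank would not be `2`
    obtain ⟨p, hp, h1⟩ : ∃ p ∈ U, ¬ VF.orbDim L p ≤ 1 := by
      by_contra! h
      have h2 : VF.rank L ≤ 1 := iSup₂_le h
      rw [hrank2] at h2
      exact absurd h2 (by norm_num)
    obtain ⟨φ, hpφ, hφ⟩ := exists_isCanonical he₁w hp (hind p hp h1)
    exact ⟨p, hp, orbDim_eq_two_of_isCanonical heL hwL hφ hpφ⟩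
  · exact exists_isCanonical he₁w hp (hind p hp (by rw [h2]; norm_num))
  · have hsub : ∀ {X}, X ∈ VF.commutatorOf g → X ∈ g.toSubmodule := fun h => hsup ▸
      Submodule.mem_sup_right h
    have lie0 : ∀ {X Y : VF U}, ⁅X, Y⁆ = 0 → ⁅φ.push X, φ.push Y⁆ = 0 := fun h => by
      rw [← φ.push_lie, h, map_zero]
    have lieS : ∀ {X Y : VF U} {c : ℝ}, ⁅X, Y⁆ = c • Y → ⁅φ.push X, φ.push Y⁆ = c • φ.push Y :=
      fun h => by rw [← φ.push_lie, h, map_smul]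
    obtain ⟨⟨c, hc⟩, ⟨d, hd, hY⟩, ⟨f, hf, hZ⟩⟩ := VF.exists_canonical_form (W := φ.range)
      (X := φ.push e₂) (Y := φ.push e₄) (Z := φ.push e₅) φ.isConnected_range hk hlam hmu hlm
      (hφ.1 ▸ lie0 (VF.lie_eq_zero_of_mem hA he₁A he₂A)) (hφ.2 ▸ lieS hw2)
      (hφ.1 ▸ lieS h₄1) (hφ.2 ▸ lie0 (VF.lie_eq_zero_of_mem_commutatorOf hab hw h₄)) (lieS h₄2)
      (VF.push_ne_zero φ (by norm_num) hdim (hsub h₄) h₄0)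
      (hφ.1 ▸ lieS h₅1) (hφ.2 ▸ lie0 (VF.lie_eq_zero_of_mem_commutatorOf hab hw h₅)) (lieS h₅2)
      (VF.push_ne_zero φ (by norm_num) hdim (hsub h₅) h₅0)
    -- the field `e₂ = (c - k y) ∂_y` vanishes at `y = c / k`
    set ψ := φ.translateY (-(c / k)) with hψ
    have hψc : ψ.IsCanonical e₁ w := φ.isCanonical_translateY hφ _
    have hpe₂ : ψ.push e₂ = (-k) • VF.yddy ψ.range := by
      refine VF.ext_on fun q hq => ?_
      rw [hψ, φ.push_translateY _ _ hq, hc _ (φ.mem_range_translateY hq), VF.smul_apply,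
        VF.yddy_apply hq]
      ext
      · simp
      · simp; field_simp; ring
    have hexp : ∀ {X : VF U} {d n : ℝ}, φ.push X = d • VF.expddy φ.range n →
        ψ.push X = d • VF.expddy ψ.range n := fun {X d n} h => by
      refine VF.ext_on fun q hq => ?_
      rw [hψ, φ.push_translateY _ _ hq, h, VF.smul_apply, VF.smul_apply,
        VF.expddy_apply _ (φ.mem_range_translateY hq), VF.expddy_apply _ hq]
      simp
    have hAm : A.toSubmodule.map ψ.push = Submodule.span ℝ {VF.ddx ψ.range, VF.yddy ψ.range} := by
      rw [hspan, Submodule.map_span, image_pair, hψc.1, hpe₂,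
        Submodule.span_pair_smul (neg_ne_zero.2 hk)]
    have hCm : (VF.commutatorOf g).map ψ.push =
        Submodule.span ℝ {VF.ddy ψ.range, VF.expddy ψ.range lam, VF.expddy ψ.range mu} := by
      rw [hC, Submodule.map_span, image_insert_eq, image_pair, hψc.2, hexp hY, hexp hZ,
        Submodule.span_triple_smul hd hf]
    have hgm : g.toSubmodule.map ψ.push = canonicalAlgebra ψ.range lam mu := by
      rw [← hsup, Submodule.map_sup, hAm, hCm]; rfl
    have hW := ψ.isConnected_range
    refine ⟨-(c / k), ψ, rfl, hψc, ?_⟩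
    rw [hgm]
    refine ⟨⟨hAm, hCm, rfl, VF.disjoint_canonical hW.nonempty lam mu⟩,
      fun z hz => ⟨orbitDim_eq_five hlam hmu hlm hz, orbitDim_lt_five⟩,
      isHypersurface_odeLocus hW.nonempty, fun S hS => ⟨?_, ?_⟩, fun D F hD hDW _ =>
      isInvariantODE_iff hlam hmu hlm hD hDW⟩
    · exact eq_odeLocus_of_isOrbitInvariant hlam hmu hlm hW.isPreconnected hS
    · rintro rfl
      exact isOrbitInvariant_odeLocus
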